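/- **Theorem 1.3.** Let $N\ge 1$ and let $f\in C^1([0,\infty))\cap C^2((0,\infty))$ satisfy $$f(0)=0,\qquad f(u)>0,\quad f'(u)>0,\quad f''(u)>0\quad\text{for all }u>0,$$ and $$F(u):=\int_u^\infty\frac{ds}{f(s)}<\infty\quad\text{for all }u>0,$$ with $F(0):=\int_0^\infty ds/f(s)=\infty$. Assume that the limit $q:=\lim_{s\to+0}f'(s)F(s)$ exists (the value $q=+\infty$ is allowed), and, if $q=1$, assume moreover that there is $s_0>0$ such that $f'(s)F(s)\ge 1$ for $0<s<s_0$. Then there exists a constant $\Gamma_*>0$, depending only on $N$ and $f$, such that for every nonnegative $u_0\in L^\infty(\mathbb{R}^N)$ satisfying $$\liminf_{|x|\to\infty}\frac{|x|^2}{F(u_0(x))}\ge\Gamma_*$$ (the lower limit being taken up to null sets, and the quotient being $0$ where $u_0(x)=0$), the problem $$\partial_t u=\Delta u+f(u)\ \text{ in }\mathbb{R}^N\times(0,\infty),\qquad u(\cdot,0)=u_0\ \text{ in }\mathbb{R}^N,$$ has no global-in-time solution. Here a global-in-time solution is a nonnegative, possibly unbounded, function $u\in C^{2,1}(\mathbb{R}^N\times(0,\infty))$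 that satisfies the equation pointwise and attains its initial value in the sense that $\int_{\mathbb{R}^N}u(x,t)\varphi(x)\,dx\to\int_{\mathbb{R}^N}u_0(x)\varphi(x)\,dx$ as $t\to+0$ for every continuous, compactly supported $\varphi$. -/

import Mathlib

open MeasureTheory Filter Topology Set
open scoped ENNReal Laplacian

/-- `F(u) = ∫_u^∞ ds / f(s)`, with values in `[0, ∞]`. For the nonlinearities considered it is
positive on `[0, ∞)`, finite on `(0, ∞)`, and infinite at `0`. -/
noncomputable def tailIntegral (f : ℝ → ℝ) (u : ℝ) : ℝ≥0∞ :=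
  ∫⁻ s in Ioi u, ENNReal.ofReal (1 / f s)

/-- `u ∈ C^{2,1}(ℝ^N × (0, ∞))`, where `u t x` is the value at time `t` and position `x`:
`u`, its spatial derivatives of order at most two, and its time derivative exist and are
jointly continuous for `t > 0`. -/
structure IsC21 {N : ℕ} (u : ℝ → EuclideanSpace ℝ (Fin N) → ℝ) : Prop where
  contDiff_space : ∀ t, 0 < t → ContDiff ℝ 2 (u t)
  differentiableAt_time : ∀ t, 0 < t → ∀ x, DifferentiableAt ℝ (fun τ => u τ x) t
  continuousOn : ContinuousOn (fun p : ℝ × EuclideanSpace ℝ (Fin N) => u p.1 p.2)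
    (Ioi 0 ×ˢ univ)
  continuousOn_fderiv : ContinuousOn
    (fun p : ℝ × EuclideanSpace ℝ (Fin N) => fderiv ℝ (u p.1) p.2) (Ioi 0 ×ˢ univ)
  continuousOn_fderiv_fderiv : ContinuousOn
    (fun p : ℝ × EuclideanSpace ℝ (Fin N) => fderiv ℝ (fderiv ℝ (u p.1)) p.2) (Ioi 0 ×ˢ univ)
  continuousOn_time : ContinuousOn
    (fun p : ℝ × EuclideanSpace ℝ (Fin N) => deriv (fun τ => u τ p.2) p.1) (Ioi 0 ×ˢ univ)

/-- `u` is a global-in-time (nonnegative, classical, possibly unbounded) solution of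
`∂_t u = Δ u + f(u)` in `ℝ^N × (0, ∞)`, `u(·, 0) = u₀`. Since `u₀` is only an element of
`L^∞(ℝ^N)`, the initial value is attained in the weak sense, that is, tested against
continuous functions with compact support. This holds in particular if `u` extends to a
continuous function on `ℝ^N × [0, ∞)` with `u(·, 0) = u₀`. -/
structure IsGlobalSolution {N : ℕ} (f : ℝ → ℝ) (u₀ : EuclideanSpace ℝ (Fin N) → ℝ)
    (u : ℝ → EuclideanSpace ℝ (Fin N) → ℝ) : Prop where
  isC21 : IsC21 u
  nonneg : ∀ t, 0 < t → ∀ x, 0 ≤ u t x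
  equation : ∀ t, 0 < t → ∀ x, deriv (fun τ => u τ x) t = Δ (u t) x + f (u t x)
  initial : ∀ φ : EuclideanSpace ℝ (Fin N) → ℝ, Continuous φ → HasCompactSupport φ →
    Tendsto (fun t => ∫ x, u t x * φ x) (𝓝[>] 0) (𝓝 (∫ x, u₀ x * φ x))

/-! Let Φ be the inverse of F, so that Φ' = -f(Φ) and Φ'' = f'(Φ) f(Φ) ≥ 0. For V = A + κt + b|x|²,
the term 4b²|x|²Φ''(V) in ΔΦ(V) has the good sign, and ∂ₜΦ(V) ≤ ΔΦ(V) + (2Nb - κ) f(Φ(V)). With κ =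
2Nb this is a subsolution of the heat equation. With κ = 2Nb - 1 it is a subsolution of the full
equation, and if 2Nb < 1 its argument at x = 0 reaches 0 in finite time, where Φ becomes infinite. A
global solution therefore cannot lie above Φ(A + b|x|²) at any positive time
(`IsGlobalSolution.false_of_lower_bound`). The growth condition yields Φ(b|x|²) ≤ u₀ near infinity
with b = 1/(3N), so 2Nb = 2/3.

It remains to find τ and A with Φ(A + b|x|²) ≤ u(τ, x) for all x
(`IsGlobalSolution.exists_lower_bound`). Far out, u is a heat supersolution and is compared with Φ(1
+ 2Nbt + b|x|²) minus a Gaussian that hides the uncontrolled values of u₀ in a ball. Convexity of f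
gives Φ(v) - Φ(v+1) ≥ C exp(-cv) with c = f'(1), so after a short time the Gaussian costs only a
unit shift of the argument. On the remaining ball u(τ) is continuous and positive, and a larger A
suffices.

Initial values are attained only weakly, so the comparison from time zero is made for the heat
equation alone: spatial mollification preserves heat supersolutions and turns weak convergence into
locally uniform bounds. The nonlinear comparison starts at τ > 0, where u is classical. In both, the
subsolution is small near infinity and u ≥ 0, so no growth bound on u is needed. -/

/-! ### Derivatives along coordinate lines and the weak maximum principle. -/

/-- `g` is twice differentiable at `s`, with second derivative `b`. -/
def HasSecondDerivAt (g : ℝ → ℝ) (b s : ℝ) : Prop :=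
  ∃ g' : ℝ → ℝ, (∀ᶠ r in 𝓝 s, HasDerivAt g (g' r) r) ∧ HasDerivAt g' b s

lemma HasSecondDerivAt.sub {g h : ℝ → ℝ} {a b s : ℝ} (hg : HasSecondDerivAt g a s)
    (hh : HasSecondDerivAt h b s) : HasSecondDerivAt (fun r => g r - h r) (a - b) s := by
  obtain ⟨g', hg1, hg2⟩ := hg
  obtain ⟨h', hh1, hh2⟩ := hh
  refine ⟨fun r => g' r - h' r, ?_, hg2.sub hh2⟩
  filter_upwards [hg1, hh1] with r h1 h2 using h1.sub h2

lemma HasSecondDerivAt.const_mul {g : ℝ → ℝ} {a s : ℝ} (c : ℝ) (hg : HasSecondDerivAt g a s) :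
    HasSecondDerivAt (fun r => c * g r) (c * a) s := by
  obtain ⟨g', hg1, hg2⟩ := hg
  refine ⟨fun r => c * g' r, ?_, hg2.const_mul c⟩
  filter_upwards [hg1] with r h1 using h1.const_mul c

lemma HasSecondDerivAt.sub_const {g : ℝ → ℝ} {a s : ℝ} (c : ℝ) (hg : HasSecondDerivAt g a s) :
    HasSecondDerivAt (fun r => g r - c) a s := by
  obtain ⟨g', hg1, hg2⟩ := hg
  exact ⟨g', hg1.mono fun r h => h.sub_const c, hg2⟩

/-- If b > 0, the second derivative test makes the point a local minimum as well, so g is locally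
constant and b = 0. -/
lemma HasSecondDerivAt.nonpos_of_isLocalMax {g : ℝ → ℝ} {b s : ℝ} (hg : HasSecondDerivAt g b s)
    (hmax : IsLocalMax g s) : b ≤ 0 := by
  obtain ⟨g', hg1, hg2⟩ := hg
  by_contra! hb
  have hd : deriv g =ᶠ[𝓝 s] g' := hg1.mono fun r h => h.deriv
  have hdd : HasDerivAt (deriv g) b s := hg2.congr_of_eventuallyEq hd
  have hmin : IsLocalMin g s :=
    isLocalMin_of_deriv_deriv_pos (by rw [hdd.deriv]; exact hb) hmax.deriv_eq_zero
      hg1.self_of_nhds.continuousAt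
  have hc : g =ᶠ[𝓝 s] fun _ => g s := by
    filter_upwards [hmax, hmin] with r h1 h2 using le_antisymm h1 h2
  have h0 : deriv g =ᶠ[𝓝 s] fun _ => 0 := by
    simpa using hc.deriv
  have := h0.deriv_eq
  rw [hdd.deriv] at this
  simp at this
  exact hb.ne' this

lemma HasDerivAt.nonneg_of_forall_le_left {h : ℝ → ℝ} {a t₀ t : ℝ} (hd : HasDerivAt h a t)
    (ht : t₀ < t) (hmax : ∀ τ ∈ Icc t₀ t, h τ ≤ h t) : 0 ≤ a := by
  have h1 : Tendsto (slope h t) (𝓝[<] t) (𝓝 a) :=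
    (hasDerivWithinAt_iff_tendsto_slope' (by simp)).1 hd.hasDerivWithinAt
  refine ge_of_tendsto h1 ?_
  filter_upwards [Ioo_mem_nhdsLT ht] with τ hτ
  rw [slope_def_field]
  exact div_nonneg_of_nonpos (by linarith [hmax τ ⟨hτ.1.le, hτ.2.le⟩]) (by linarith [hτ.2])

/-- At `(t, x)`, the function `z` has time derivative `a` and pure second spatial derivatives
`d i` along the coordinate axes. -/
structure HasHeatDerivAt {N : ℕ} (z : ℝ → EuclideanSpace ℝ (Fin N) → ℝ) (t : ℝ)
    (x : EuclideanSpace ℝ (Fin N)) (a : ℝ) (d : Fin N → ℝ) : Prop where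
  time : HasDerivAt (fun τ => z τ x) a t
  space : ∀ i, HasSecondDerivAt (fun s : ℝ => z t (x + s • EuclideanSpace.single i 1)) (d i) 0

lemma HasHeatDerivAt.sub {N : ℕ} {z w : ℝ → EuclideanSpace ℝ (Fin N) → ℝ} {t : ℝ}
    {x : EuclideanSpace ℝ (Fin N)} {a b : ℝ} {d e : Fin N → ℝ} (hz : HasHeatDerivAt z t x a d)
    (hw : HasHeatDerivAt w t x b e) :
    HasHeatDerivAt (fun τ y => z τ y - w τ y) t x (a - b) (fun i => d i - e i) :=
  ⟨hz.time.sub hw.time, fun i => (hz.space i).sub (hw.space i)⟩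

lemma HasHeatDerivAt.const_mul {N : ℕ} {z : ℝ → EuclideanSpace ℝ (Fin N) → ℝ} {t : ℝ}
    {x : EuclideanSpace ℝ (Fin N)} {a : ℝ} {d : Fin N → ℝ} (c : ℝ)
    (hz : HasHeatDerivAt z t x a d) :
    HasHeatDerivAt (fun τ y => c * z τ y) t x (c * a) (fun i => c * d i) :=
  ⟨hz.time.const_mul c, fun i => (hz.space i).const_mul c⟩

lemma HasHeatDerivAt.sub_time {N : ℕ} {z : ℝ → EuclideanSpace ℝ (Fin N) → ℝ} {t : ℝ}
    {x : EuclideanSpace ℝ (Fin N)} {a b : ℝ} {d : Fin N → ℝ} {c : ℝ → ℝ}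
    (hz : HasHeatDerivAt z t x a d) (hc : HasDerivAt c b t) :
    HasHeatDerivAt (fun τ y => z τ y - c τ) t x (a - b) d :=
  ⟨hz.time.sub hc, fun i => (hz.space i).sub_const _⟩

/-- Weak maximum principle on a parabolic cylinder. -/
theorem nonpos_of_heat_ineq {N : ℕ} {z : ℝ → EuclideanSpace ℝ (Fin N) → ℝ} {t₀ t₁ L K : ℝ}
    (hc : ContinuousOn (fun p : ℝ × EuclideanSpace ℝ (Fin N) => z p.1 p.2)
      (Icc t₀ t₁ ×ˢ Metric.closedBall 0 L))
    (h0 : ∀ x ∈ Metric.closedBall (0 : EuclideanSpace ℝ (Fin N)) L, z t₀ x ≤ 0)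
    (hL : ∀ t ∈ Icc t₀ t₁, ∀ x, ‖x‖ = L → z t x ≤ 0)
    (hz : ∀ t ∈ Ioc t₀ t₁, ∀ x ∈ Metric.ball (0 : EuclideanSpace ℝ (Fin N)) L, 0 < z t x →
      ∃ a d, HasHeatDerivAt z t x a d ∧ a ≤ ∑ i, d i + K * z t x) :
    ∀ t ∈ Icc t₀ t₁, ∀ x ∈ Metric.closedBall (0 : EuclideanSpace ℝ (Fin N)) L, z t x ≤ 0 := by
  intro t ht x hx
  by_contra! hpos
  -- At a positive maximum of the weighted function, a ≥ (K + 1) z and every second derivative is ≤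
  -- 0, while the hypothesis gives a ≤ K z; the extra 1 makes this contradictory.
  set k : ℝ × EuclideanSpace ℝ (Fin N) → ℝ := fun p => Real.exp (-(K + 1) * p.1) * z p.1 p.2
    with hk
  have hkc : ContinuousOn k (Icc t₀ t₁ ×ˢ Metric.closedBall 0 L) := by
    refine ContinuousOn.mul ?_ hc
    exact Continuous.continuousOn (by fun_prop)
  have hcomp : IsCompact (Icc t₀ t₁ ×ˢ Metric.closedBall (0 : EuclideanSpace ℝ (Fin N)) L) :=
    isCompact_Icc.prod (isCompact_closedBall _ _)
  obtain ⟨⟨τ, y⟩, ⟨hτ, hy⟩, hmax⟩ := hcomp.exists_isMaxOn ⟨(t, x), ht, hx⟩ hkc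
  simp only at hτ hy
  have hkpos : 0 < k (τ, y) :=
    (mul_pos (Real.exp_pos _) hpos).trans_le (hmax (show (t, x) ∈ _ from ⟨ht, hx⟩))
  have hzpos : 0 < z τ y := by
    by_contra! h
    exact hkpos.not_ge (mul_nonpos_of_nonneg_of_nonpos (Real.exp_pos _).le h)
  have hτ0 : t₀ < τ := by
    rcases hτ.1.eq_or_lt with h | h
    · subst h; exact absurd (h0 y hy) (not_le.2 hzpos)
    · exact h
  have hyL : y ∈ Metric.ball (0 : EuclideanSpace ℝ (Fin N)) L := by
    rw [mem_ball_zero_iff]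
    rw [mem_closedBall_zero_iff] at hy
    rcases hy.eq_or_lt with h | h
    · exact absurd (hL τ hτ y h) (not_le.2 hzpos)
    · exact h
  obtain ⟨a, d, hd, had⟩ := hz τ ⟨hτ0, hτ.2⟩ y hyL hzpos
  have hexp : HasDerivAt (fun s => Real.exp (-(K + 1) * s))
      (Real.exp (-(K + 1) * τ) * -(K + 1)) τ := by
    simpa using ((hasDerivAt_id τ).const_mul (-(K + 1))).exp
  have ht' := (hexp.mul hd.time).nonneg_of_forall_le_left hτ0 (fun s hs =>
    hmax (show (s, y) ∈ _ from ⟨⟨hs.1, hs.2.trans hτ.2⟩, hy⟩))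
  have hdi : ∀ i, d i ≤ 0 := by
    intro i
    refine (hd.space i).nonpos_of_isLocalMax ?_
    have hcont : ContinuousAt (fun s : ℝ => y + s • EuclideanSpace.single i (1 : ℝ)) 0 := by
      fun_prop
    have : ∀ᶠ s : ℝ in 𝓝 0, y + s • EuclideanSpace.single i (1 : ℝ) ∈ Metric.ball 0 L :=
      hcont.preimage_mem_nhds (by
        rw [zero_smul, add_zero]
        exact Metric.isOpen_ball.mem_nhds hyL)
    filter_upwards [this] with s hs
    have := hmax (show (τ, y + s • EuclideanSpace.single i (1 : ℝ)) ∈ _ from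
      ⟨hτ, Metric.ball_subset_closedBall hs⟩)
    simp only [hk, mem_ofPred_eq] at this
    simpa using le_of_mul_le_mul_left this (Real.exp_pos _)
  have hsum : ∑ i, d i ≤ 0 := Finset.sum_nonpos fun i _ => hdi i
  have : 0 ≤ Real.exp (-(K + 1) * τ) * (a - (K + 1) * z τ y) := by linarith
  have := nonneg_of_mul_nonneg_right this (Real.exp_pos _)
  linarith

/-! ### Spatial mollification of heat supersolutions. -/

/-- Differentiation under the integral sign against a compactly supported continuous weight. -/
lemma hasDerivAt_integral_mul_of_continuousOn {N : ℕ} {ρ : EuclideanSpace ℝ (Fin N) → ℝ}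
    (hρ : Continuous ρ) (hρc : HasCompactSupport ρ) {I : Set ℝ} (hI : IsOpen I)
    {g g' : ℝ → EuclideanSpace ℝ (Fin N) → ℝ}
    (hg : ∀ s ∈ I, Continuous (g s)) (hgg : ∀ s ∈ I, ∀ y, HasDerivAt (fun r => g r y) (g' s y) s)
    (hg' : ContinuousOn (fun p : ℝ × EuclideanSpace ℝ (Fin N) => g' p.1 p.2) (I ×ˢ univ))
    {s : ℝ} (hs : s ∈ I) :
    HasDerivAt (fun r => ∫ y, ρ y * g r y) (∫ y, ρ y * g' s y) s := by
  obtain ⟨ε, hε, hεI⟩ := Metric.nhds_basis_closedBall.mem_iff.1 (hI.mem_nhds hs)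
  have hcomp : IsCompact (Metric.closedBall s ε ×ˢ tsupport ρ) :=
    (isCompact_closedBall _ _).prod hρc
  obtain ⟨C, hC⟩ := hcomp.exists_bound_of_continuousOn
    (hg'.mono (prod_mono hεI (subset_univ _)))
  have hint : ∀ h : EuclideanSpace ℝ (Fin N) → ℝ, Continuous h →
      Integrable (fun y => ρ y * h y) := fun h hh =>
    (hρ.mul hh).integrable_of_hasCompactSupport hρc.mul_right
  have hg'c : Continuous (g' s) := by
    rw [← continuousOn_univ]
    exact hg'.comp (f := fun y => (s, y)) (by fun_prop) fun y _ => ⟨hs, mem_univ _⟩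
  refine (hasDerivAt_integral_of_dominated_loc_of_deriv_le
    (F := fun r y => ρ y * g r y) (F' := fun r y => ρ y * g' r y)
    (bound := fun y => |ρ y| * C) (Metric.closedBall_mem_nhds s hε) ?_
    (hint _ (hg s hs)) (hint _ hg'c).aestronglyMeasurable ?_ ?_ ?_).2
  · filter_upwards [hI.mem_nhds hs] with r hr
    exact (hint _ (hg r hr)).aestronglyMeasurable
  · refine ae_of_all _ fun y r hr => ?_
    by_cases hy : y ∈ tsupport ρ
    · rw [norm_mul, Real.norm_eq_abs]
      exact mul_le_mul_of_nonneg_left (hC (r, y) ⟨hr, hy⟩) (abs_nonneg _)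
    · simp [image_eq_zero_of_notMem_tsupport hy]
  · exact (hρ.abs.integrable_of_hasCompactSupport hρc.norm).mul_const C
  · exact ae_of_all _ fun y r hr => (hgg r (hεI hr) y).const_mul (ρ y)

/-- A nonnegative classical supersolution of the heat equation for positive times. -/
structure IsHeatSupersolution {N : ℕ} (u : ℝ → EuclideanSpace ℝ (Fin N) → ℝ) : Prop where
  isC21 : IsC21 u
  nonneg : ∀ t, 0 < t → ∀ x, 0 ≤ u t x
  laplacian_le : ∀ t, 0 < t → ∀ x, Δ (u t) x ≤ deriv (fun τ => u τ x) t

lemma laplacian_eq_sum_fderiv {N : ℕ} (v : EuclideanSpace ℝ (Fin N) → ℝ)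
    (x : EuclideanSpace ℝ (Fin N)) :
    Δ v x = ∑ i, fderiv ℝ (fderiv ℝ v) x (EuclideanSpace.single i 1)
      (EuclideanSpace.single i 1) := by
  rw [InnerProductSpace.laplacian_eq_iteratedFDeriv_orthonormalBasis v
    (EuclideanSpace.basisFun (Fin N) ℝ)]
  simp [iteratedFDeriv_two_apply]

lemma hasDerivAt_comp_line {N : ℕ} {F : Type*} [NormedAddCommGroup F] [NormedSpace ℝ F]
    {v : EuclideanSpace ℝ (Fin N) → F} (hv : Differentiable ℝ v)
    (x e : EuclideanSpace ℝ (Fin N)) (s : ℝ) :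
    HasDerivAt (fun r : ℝ => v (x + r • e)) (fderiv ℝ v (x + s • e) e) s := by
  have h1 : HasDerivAt (fun r : ℝ => x + r • e) e s := by
    simpa using ((hasDerivAt_id s).smul_const e).const_add x
  exact (hv _).hasFDerivAt.comp_hasDerivAt s h1

lemma hasDerivAt_fderiv_comp_line {N : ℕ} {v : EuclideanSpace ℝ (Fin N) → ℝ}
    (hv : ContDiff ℝ 2 v) (x e : EuclideanSpace ℝ (Fin N)) (s : ℝ) :
    HasDerivAt (fun r : ℝ => fderiv ℝ v (x + r • e) e)
      (fderiv ℝ (fderiv ℝ v) (x + s • e) e e) s := by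
  have h : Differentiable ℝ (fderiv ℝ v) :=
    (hv.fderiv_right (m := 1) (by norm_num)).differentiable (by norm_num)
  have h2 := hasDerivAt_comp_line h x e s
  simpa using h2.clm_apply (hasDerivAt_const s e)

lemma IsC21.hasHeatDerivAt {N : ℕ} {u : ℝ → EuclideanSpace ℝ (Fin N) → ℝ} (hu : IsC21 u)
    {t : ℝ} (ht : 0 < t) (x : EuclideanSpace ℝ (Fin N)) :
    HasHeatDerivAt u t x (deriv (fun τ => u τ x) t)
      (fun i => fderiv ℝ (fderiv ℝ (u t)) x (EuclideanSpace.single i 1)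
        (EuclideanSpace.single i 1)) := by
  refine ⟨(hu.differentiableAt_time t ht x).hasDerivAt, fun i => ?_⟩
  have hc := hu.contDiff_space t ht
  refine ⟨_, Eventually.of_forall fun r => hasDerivAt_comp_line (hc.differentiable (by norm_num)) x
    (EuclideanSpace.single i 1) r, ?_⟩
  simpa using hasDerivAt_fderiv_comp_line hc x (EuclideanSpace.single i 1) 0

/-- Spatial mollification `ρ * u(t)`. -/
noncomputable def spaceMollify {N : ℕ} (ρ : EuclideanSpace ℝ (Fin N) → ℝ)
    (u : ℝ → EuclideanSpace ℝ (Fin N) → ℝ) (t : ℝ) (x : EuclideanSpace ℝ (Fin N)) : ℝ :=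
  ∫ y, ρ y * u t (x - y)

lemma spaceMollify_eq {N : ℕ} (ρ : EuclideanSpace ℝ (Fin N) → ℝ)
    (u : ℝ → EuclideanSpace ℝ (Fin N) → ℝ) (t : ℝ) (x : EuclideanSpace ℝ (Fin N)) :
    spaceMollify ρ u t x = ∫ y, u t y * ρ (x - y) := by
  rw [spaceMollify, ← integral_sub_left_eq_self _ volume x]
  simp [mul_comm]

/-- All derivatives fall on u under the integral, and integrating Δu ≤ ∂ₜu against ρ ≥ 0 keeps the
inequality. -/
lemma IsHeatSupersolution.hasHeatDerivAt_spaceMollify {N : ℕ}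
    {ρ : EuclideanSpace ℝ (Fin N) → ℝ} {u : ℝ → EuclideanSpace ℝ (Fin N) → ℝ}
    (hu : IsHeatSupersolution u) (hρ : Continuous ρ) (hρc : HasCompactSupport ρ)
    (hρ0 : ∀ y, 0 ≤ ρ y) {t : ℝ} (ht : 0 < t) (x : EuclideanSpace ℝ (Fin N)) :
    ∃ a d, HasHeatDerivAt (spaceMollify ρ u) t x a d ∧ ∑ i, d i ≤ a := by
  have hC := hu.isC21
  have hint : ∀ h : EuclideanSpace ℝ (Fin N) → ℝ, Continuous h →
      Integrable (fun y => ρ y * h y) := fun h hh =>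
    (hρ.mul hh).integrable_of_hasCompactSupport hρc.mul_right
  have hslice : ∀ {F : Type} [TopologicalSpace F]
      {G : ℝ × EuclideanSpace ℝ (Fin N) → F}, ContinuousOn G (Ioi 0 ×ˢ univ) →
      Continuous fun y => G (t, x - y) := fun {F} _ {G} hG => by
    rw [← continuousOn_univ]
    exact hG.comp (f := fun y => (t, x - y)) (by fun_prop) fun y _ => ⟨ht, mem_univ _⟩
  have hcd := hC.contDiff_space t ht
  refine ⟨∫ y, ρ y * deriv (fun τ => u τ (x - y)) t,
    fun i => ∫ y, ρ y * fderiv ℝ (fderiv ℝ (u t)) (x - y) (EuclideanSpace.single i 1)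
      (EuclideanSpace.single i 1), ⟨?_, fun i => ?_⟩, ?_⟩
  · refine hasDerivAt_integral_mul_of_continuousOn hρ hρc isOpen_Ioi
      (g := fun τ y => u τ (x - y)) (g' := fun τ y => deriv (fun τ => u τ (x - y)) τ) ?_ ?_ ?_ ht
    · intro s hs
      exact (hC.contDiff_space s hs).continuous.comp (by fun_prop)
    · intro s hs y
      exact (hC.differentiableAt_time s hs _).hasDerivAt
    · exact hC.continuousOn_time.comp
        (f := fun p : ℝ × EuclideanSpace ℝ (Fin N) => (p.1, x - p.2)) (by fun_prop)
        fun p hp => ⟨hp.1, mem_univ _⟩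
  · have hd1 : Continuous (fderiv ℝ (u t)) := hcd.continuous_fderiv (by norm_num)
    have hd2 : Continuous (fderiv ℝ (fderiv ℝ (u t))) :=
      (hcd.fderiv_right (m := 1) (by norm_num)).continuous_fderiv (by norm_num)
    refine ⟨fun s => ∫ y, ρ y * fderiv ℝ (u t) (x - y + s • EuclideanSpace.single i 1)
      (EuclideanSpace.single i 1), Eventually.of_forall fun s => ?_, ?_⟩
    · have := hasDerivAt_integral_mul_of_continuousOn hρ hρc isOpen_univ
        (g := fun s y => u t (x - y + s • EuclideanSpace.single i 1))
        (g' := fun s y => fderiv ℝ (u t) (x - y + s • EuclideanSpace.single i 1)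
          (EuclideanSpace.single i 1)) ?_ ?_ ?_ (mem_univ s)
      · convert this using 2 with r
        simp only [spaceMollify]
        congr! 4
        abel
      · intro r _
        exact hcd.continuous.comp (by fun_prop)
      · intro r _ y
        exact hasDerivAt_comp_line (hcd.differentiable (by norm_num)) _ _ _
      · refine Continuous.continuousOn ?_
        exact (hd1.comp (f := fun p : ℝ × EuclideanSpace ℝ (Fin N) =>
          x - p.2 + p.1 • EuclideanSpace.single i 1) (by fun_prop)).clm_apply continuous_const
    · have := hasDerivAt_integral_mul_of_continuousOn hρ hρc isOpen_univ
        (g := fun s y => fderiv ℝ (u t) (x - y + s • EuclideanSpace.single i 1)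
          (EuclideanSpace.single i 1))
        (g' := fun s y => fderiv ℝ (fderiv ℝ (u t)) (x - y + s • EuclideanSpace.single i 1)
          (EuclideanSpace.single i 1) (EuclideanSpace.single i 1)) ?_ ?_ ?_ (mem_univ 0)
      · simpa using this
      · intro r _
        exact (hd1.comp (f := fun y : EuclideanSpace ℝ (Fin N) =>
          x - y + r • EuclideanSpace.single i 1) (by fun_prop)).clm_apply continuous_const
      · intro r _ y
        exact hasDerivAt_fderiv_comp_line hcd _ _ _
      · refine Continuous.continuousOn ?_
        exact ((hd2.comp (f := fun p : ℝ × EuclideanSpace ℝ (Fin N) =>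
          x - p.2 + p.1 • EuclideanSpace.single i 1) (by fun_prop)).clm_apply
            continuous_const).clm_apply continuous_const
  · have hd2 : ∀ i, Continuous fun y => fderiv ℝ (fderiv ℝ (u t)) (x - y)
        (EuclideanSpace.single i 1) (EuclideanSpace.single i 1) := fun i =>
      ((hslice hC.continuousOn_fderiv_fderiv).clm_apply continuous_const).clm_apply
        continuous_const
    rw [← integral_finsetSum _ fun i _ => hint _ (hd2 i)]
    refine integral_mono (integrable_finsetSum _ fun i _ => hint _ (hd2 i))
      (hint _ (hslice hC.continuousOn_time)) fun y => ?_
    simp only [← Finset.mul_sum]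
    refine mul_le_mul_of_nonneg_left ?_ (hρ0 y)
    rw [← laplacian_eq_sum_fderiv]
    exact hu.laplacian_le t ht _

lemma IsHeatSupersolution.continuousOn_spaceMollify {N : ℕ}
    {ρ : EuclideanSpace ℝ (Fin N) → ℝ} {u : ℝ → EuclideanSpace ℝ (Fin N) → ℝ}
    (hu : IsHeatSupersolution u) (hρ : Continuous ρ) (hρc : HasCompactSupport ρ) :
    ContinuousOn (fun p : ℝ × EuclideanSpace ℝ (Fin N) => spaceMollify ρ u p.1 p.2)
      (Ioi 0 ×ˢ univ) := by
  refine continuousOn_integral_of_compact_support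
    (f := fun (p : ℝ × EuclideanSpace ℝ (Fin N)) y => ρ y * u p.1 (p.2 - y)) hρc ?_ ?_
  · refine ContinuousOn.mul (by fun_prop) ?_
    exact hu.isC21.continuousOn.comp
      (f := fun q : (ℝ × EuclideanSpace ℝ (Fin N)) × EuclideanSpace ℝ (Fin N) =>
        (q.1.1, q.1.2 - q.2)) (by fun_prop) fun q hq => ⟨hq.1.1, mem_univ _⟩
  · intro p y _ hy
    simp [image_eq_zero_of_notMem_tsupport hy]

/-! ### Comparison with weakly attained initial values. -/

/-- A nonnegative Lipschitz kernel of unit mass supported in a small ball. -/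
lemma exists_mollifier (N : ℕ) {η : ℝ} (hη : 0 < η) :
    ∃ (ρ : EuclideanSpace ℝ (Fin N) → ℝ) (C : NNReal), LipschitzWith C ρ ∧ HasCompactSupport ρ ∧
      (∀ y, 0 ≤ ρ y) ∧ (∀ y, η ≤ ‖y‖ → ρ y = 0) ∧ ∫ y, ρ y = 1 := by
  let b : ContDiffBump (0 : EuclideanSpace ℝ (Fin N)) := ⟨η / 2, η, by linarith, by linarith⟩
  have hsm : ContDiff ℝ 1 (b.normed volume) := b.contDiff_normed
  obtain ⟨C, hC⟩ := hsm.lipschitzWith_of_hasCompactSupport b.hasCompactSupport_normed one_ne_zero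
  refine ⟨b.normed volume, C, hC, b.hasCompactSupport_normed,
    fun y => b.nonneg_normed y, fun y hy => ?_, b.integral_normed⟩
  have : y ∉ Function.support (b.normed volume) := by
    rw [b.support_normed_eq]
    simpa using hy
  simpa using this

lemma exists_cutoff (N : ℕ) (R : ℝ) :
    ∃ χ : EuclideanSpace ℝ (Fin N) → ℝ, Continuous χ ∧ HasCompactSupport χ ∧
      (∀ y, 0 ≤ χ y) ∧ ∀ y, ‖y‖ ≤ R → χ y = 1 := by
  let b : ContDiffBump (0 : EuclideanSpace ℝ (Fin N)) :=
    ⟨|R| + 1, |R| + 2, by positivity, by linarith⟩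
  refine ⟨b, b.continuous, b.hasCompactSupport, fun y => b.nonneg, fun y hy => ?_⟩
  refine b.one_of_mem_closedBall ?_
  rw [mem_closedBall_zero_iff]
  exact hy.trans ((le_abs_self R).trans (by linarith))

/-- An equi-Lipschitz family with pointwise limit at least `g` is eventually uniformly bounded below
by `g - ε` on compact sets. -/
lemma eventually_forall_sub_lt_of_lipschitz {X ι : Type*} [PseudoMetricSpace X] {l : Filter ι}
    {K : Set X} (hK : IsCompact K) {w : ι → X → ℝ} {w₀ g : X → ℝ} {Λ : ℝ}
    (hw : ∀ x ∈ K, Tendsto (fun t => w t x) l (𝓝 (w₀ x))) (hg : ContinuousOn g K)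
    (hgw : ∀ x ∈ K, g x ≤ w₀ x)
    (hΛ : ∀ᶠ t in l, ∀ x ∈ K, ∀ y ∈ K, |w t x - w t y| ≤ Λ * dist x y)
    {ε : ℝ} (hε : 0 < ε) : ∀ᶠ t in l, ∀ x ∈ K, g x - ε < w t x := by
  refine hK.induction_on (p := fun s => ∀ᶠ t in l, ∀ x ∈ s, x ∈ K → g x - ε < w t x)
    (by simp) (fun s t hst h => h.mono fun _ h x hx => h x (hst hx))
    (fun s t hs ht => by
      filter_upwards [hs, ht] with r h1 h2 x hx
      exact hx.elim (h1 x) (h2 x)) (fun x hx => ?_) |>.mono fun t h x hx => h x hx hx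
  have h1 : ∀ᶠ y in 𝓝[K] x, g y < g x + ε / 3 :=
    (hg x hx).eventually (gt_mem_nhds (by linarith))
  have h2 : ∀ᶠ y in 𝓝[K] x, Λ * dist x y < ε / 3 := by
    have : Tendsto (fun y => Λ * dist x y) (𝓝[K] x) (𝓝 (Λ * dist x x)) :=
      Continuous.continuousWithinAt (by fun_prop)
    refine this.eventually (gt_mem_nhds ?_)
    simpa using hε
  refine ⟨_, h1.and h2, ?_⟩
  filter_upwards [hΛ, (hw x hx).eventually (lt_mem_nhds (show w₀ x - ε / 3 < w₀ x by linarith))]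
    with t h3 h4 y hy hyK
  obtain ⟨h5, h6⟩ := hy
  have := le_abs_self (w t x - w t y)
  have := h3 x hx y hyK
  have := hgw x hx
  linarith

lemma le_integral_mul_of_le {N : ℕ} {ρ g : EuclideanSpace ℝ (Fin N) → ℝ} {c : ℝ}
    (hρi : Integrable ρ) (hρ0 : ∀ y, 0 ≤ ρ y) (hρ1 : ∫ y, ρ y = 1)
    (hi : Integrable fun y => ρ y * g y) (hg : ∀ᵐ y, ρ y ≠ 0 → c ≤ g y) :
    c ≤ ∫ y, ρ y * g y := by
  calc c = ∫ y, ρ y * c := by rw [integral_mul_const, hρ1, one_mul]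
    _ ≤ _ := by
      refine integral_mono_ae (hρi.mul_const c) hi ?_
      filter_upwards [hg] with y hy
      by_cases h : ρ y = 0
      · simp [h]
      · exact mul_le_mul_of_nonneg_left (hy h) (hρ0 y)

lemma integral_mul_le_of_le {N : ℕ} {ρ g : EuclideanSpace ℝ (Fin N) → ℝ} {c : ℝ}
    (hρi : Integrable ρ) (hρ0 : ∀ y, 0 ≤ ρ y) (hρ1 : ∫ y, ρ y = 1)
    (hi : Integrable fun y => ρ y * g y) (hg : ∀ᵐ y, ρ y ≠ 0 → g y ≤ c) :
    ∫ y, ρ y * g y ≤ c := by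
  have := le_integral_mul_of_le (g := fun y => -g y) (c := -c) hρi hρ0 hρ1
    (by simpa using hi.neg) (hg.mono fun y hy h => neg_le_neg (hy h))
  simp only [mul_neg, integral_neg] at this
  exact neg_le_neg_iff.1 this

/-- Mollifications of a heat supersolution attain the mollified initial value from above, locally
uniformly. -/
lemma IsHeatSupersolution.eventually_lt_spaceMollify {N : ℕ}
    {u : ℝ → EuclideanSpace ℝ (Fin N) → ℝ} {u₀ : EuclideanSpace ℝ (Fin N) → ℝ}
    (hu : IsHeatSupersolution u)
    (hinit : ∀ φ : EuclideanSpace ℝ (Fin N) → ℝ, Continuous φ → HasCompactSupport φ →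
      Tendsto (fun t => ∫ x, u t x * φ x) (𝓝[>] 0) (𝓝 (∫ x, u₀ x * φ x)))
    {ρ : EuclideanSpace ℝ (Fin N) → ℝ} {C : NNReal} (hρ : LipschitzWith C ρ)
    (hρc : HasCompactSupport ρ) (hρz : ∀ y, 1 ≤ ‖y‖ → ρ y = 0) {g : EuclideanSpace ℝ (Fin N) → ℝ}
    {L : ℝ} (hg : ContinuousOn g (Metric.closedBall 0 L))
    (hgu : ∀ x ∈ Metric.closedBall (0 : EuclideanSpace ℝ (Fin N)) L, g x ≤ ∫ y, u₀ y * ρ (x - y))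
    {ε : ℝ} (hε : 0 < ε) :
    ∀ᶠ t in 𝓝[>] 0, ∀ x ∈ Metric.closedBall (0 : EuclideanSpace ℝ (Fin N)) L,
      g x - ε < spaceMollify ρ u t x := by
  have hshift : ∀ x, Continuous (fun y => ρ (x - y)) ∧ HasCompactSupport fun y => ρ (x - y) :=
    fun x => ⟨hρ.continuous.comp (by fun_prop), hρc.comp_homeomorph (Homeomorph.subLeft x)⟩
  obtain ⟨χ, hχ, hχc, hχ0, hχ1⟩ := exists_cutoff N (L + 1)
  -- The Lipschitz constant of ρ * u(t) on the ball is at most that of ρ times the mass of u(t) in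
  -- radius L + 1. Testing the initial condition with χ bounds this mass for small t.
  refine eventually_forall_sub_lt_of_lipschitz (isCompact_closedBall _ _)
    (w₀ := fun x => ∫ y, u₀ y * ρ (x - y)) (Λ := C * ((∫ y, u₀ y * χ y) + 1)) ?_ hg hgu ?_ hε
  · intro x _
    simp only [spaceMollify_eq]
    exact hinit _ (hshift x).1 (hshift x).2
  · filter_upwards [(hinit χ hχ hχc).eventually (gt_mem_nhds (lt_add_one _)),
      self_mem_nhdsWithin] with t ht ht0 x hx x' hx'
    have hcont := (hu.isC21.contDiff_space t ht0).continuous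
    have hint : ∀ φ : EuclideanSpace ℝ (Fin N) → ℝ, Continuous φ → HasCompactSupport φ →
        Integrable fun y => u t y * φ y := fun φ h1 h2 =>
      (hcont.mul h1).integrable_of_hasCompactSupport h2.mul_left
    rw [spaceMollify_eq, spaceMollify_eq, ← integral_sub (hint _ (hshift x).1 (hshift x).2)
      (hint _ (hshift x').1 (hshift x').2)]
    have hzero : ∀ x ∈ Metric.closedBall (0 : EuclideanSpace ℝ (Fin N)) L, ∀ y, L + 1 < ‖y‖ →
        ρ (x - y) = 0 := fun x hx y hy => by
      refine hρz _ ?_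
      rw [mem_closedBall_zero_iff] at hx
      have := norm_sub_norm_le y x
      rw [norm_sub_rev] at this
      linarith
    calc |∫ y, (u t y * ρ (x - y) - u t y * ρ (x' - y))|
        ≤ ∫ y, C * dist x x' * (u t y * χ y) := by
          rw [← Real.norm_eq_abs]
          refine norm_integral_le_of_norm_le ((hint χ hχ hχc).const_mul _) (ae_of_all _ fun y => ?_)
          rw [← mul_sub, norm_mul, Real.norm_of_nonneg (hu.nonneg t ht0 y)]
          by_cases hy : ‖y‖ ≤ L + 1
          · have h1 := hρ.dist_le_mul (x - y) (x' - y)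
            rw [dist_sub_right, dist_eq_norm] at h1
            rw [hχ1 y hy, mul_one, mul_comm]
            exact mul_le_mul_of_nonneg_right h1 (hu.nonneg t ht0 y)
          · rw [hzero x hx y (not_le.1 hy), hzero x' hx' y (not_le.1 hy)]
            simp only [sub_self, norm_zero, mul_zero]
            exact mul_nonneg (by positivity) (mul_nonneg (hu.nonneg t ht0 y) (hχ0 y))
      _ = C * dist x x' * ∫ y, u t y * χ y := integral_const_mul _ _
      _ ≤ C * dist x x' * ((∫ y, u₀ y * χ y) + 1) :=
          mul_le_mul_of_nonneg_left ht.le (by positivity)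
      _ = _ := by ring

/-- Comparison of a heat supersolution with weak initial values and a classical subsolution that is
small near spatial infinity. -/
theorem IsHeatSupersolution.ge_of_subsolution {N : ℕ}
    {u : ℝ → EuclideanSpace ℝ (Fin N) → ℝ} {u₀ : EuclideanSpace ℝ (Fin N) → ℝ}
    (hu : IsHeatSupersolution u)
    (hinit : ∀ φ : EuclideanSpace ℝ (Fin N) → ℝ, Continuous φ → HasCompactSupport φ →
      Tendsto (fun t => ∫ x, u t x * φ x) (𝓝[>] 0) (𝓝 (∫ x, u₀ x * φ x)))
    (hu₀ : LocallyIntegrable u₀) {ζ : ℝ → EuclideanSpace ℝ (Fin N) → ℝ} {τ : ℝ}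
    (hζc : ContinuousOn (fun p : ℝ × EuclideanSpace ℝ (Fin N) => ζ p.1 p.2) (Icc 0 τ ×ˢ univ))
    (hζ0 : ∀ᵐ x, ζ 0 x ≤ u₀ x)
    (hdecay : ∀ ε > 0, ∃ L, ∀ t ∈ Icc 0 τ, ∀ x, L ≤ ‖x‖ → ζ t x ≤ ε)
    (hsub : ∀ t ∈ Ioc 0 τ, ∀ x, ∃ a d, HasHeatDerivAt ζ t x a d ∧ a ≤ ∑ i, d i) :
    ∀ t ∈ Ioc 0 τ, ∀ x, ζ t x ≤ u t x := by
  intro t ht x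
  refine le_of_forall_pos_le_add fun δ hδ => ?_
  -- One ε pays for replacing ρ * u by u at (t, x). The other four are the margin in the cylinder,
  -- of which the initial slice uses three and the lateral boundary one.
  obtain ⟨ε, hε, hεδ⟩ : ∃ ε > 0, 5 * ε = δ := ⟨δ / 5, by positivity, by ring⟩
  obtain ⟨L₀, hL₀⟩ := hdecay ε hε
  obtain ⟨L, hLL, hLx⟩ : ∃ L, L₀ ≤ L ∧ ‖x‖ < L :=
    ⟨max L₀ (‖x‖ + 1), le_max_left _ _, (lt_add_one _).trans_le (le_max_right _ _)⟩
  have hζ0c : Continuous (ζ 0) := by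
    rw [← continuousOn_univ]
    exact hζc.comp (f := fun y => ((0 : ℝ), y)) (by fun_prop)
      fun y _ => ⟨⟨le_rfl, ht.1.le.trans ht.2⟩, mem_univ _⟩
  have huc := (hu.isC21.contDiff_space t ht.1).continuous
  obtain ⟨η₁, hη₁, h1⟩ := Metric.continuousAt_iff.1 huc.continuousAt ε hε
  obtain ⟨η₂, hη₂, h2⟩ := Metric.uniformContinuousOn_iff.1
    ((isCompact_closedBall (0 : EuclideanSpace ℝ (Fin N)) (L + 1)).uniformContinuousOn_of_continuous
      hζ0c.continuousOn) ε hε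
  obtain ⟨η₃, hη₃, h3⟩ := Metric.uniformContinuousOn_iff.1
    (((isCompact_Icc (a := (0 : ℝ)) (b := τ)).prod
      (isCompact_closedBall (0 : EuclideanSpace ℝ (Fin N)) L)).uniformContinuousOn_of_continuous
      (hζc.mono (prod_mono_right (subset_univ _)))) ε hε
  obtain ⟨η, hη, hηle⟩ : ∃ η > 0, η ≤ 1 ∧ η ≤ η₁ ∧ η ≤ η₂ :=
    ⟨min 1 (min η₁ η₂), lt_min one_pos (lt_min hη₁ hη₂), by simp⟩
  obtain ⟨ρ, C, hρ, hρc, hρ0, hρz, hρ1⟩ := exists_mollifier N hη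
  have hρi : Integrable ρ := hρ.continuous.integrable_of_hasCompactSupport hρc
  have hρη : ∀ y, ρ y ≠ 0 → ‖y‖ < 1 ∧ ‖y‖ < η₁ ∧ ‖y‖ < η₂ := fun y hy => by
    have : ‖y‖ < η := by
      by_contra! h
      exact hy (hρz y h)
    exact ⟨this.trans_le hηle.1, this.trans_le hηle.2.1, this.trans_le hηle.2.2⟩
  have hw0 : ∀ y ∈ Metric.closedBall (0 : EuclideanSpace ℝ (Fin N)) L,
      ζ 0 y - ε ≤ ∫ v, u₀ v * ρ (y - v) := by
    intro y hy
    have hsc : Continuous fun v => ρ (y - v) := hρ.continuous.comp (by fun_prop)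
    have hscc : HasCompactSupport fun v => ρ (y - v) :=
      hρc.comp_homeomorph (Homeomorph.subLeft y)
    have := le_integral_mul_of_le (ρ := fun v => ρ (y - v)) (g := u₀) (c := ζ 0 y - ε)
      (hsc.integrable_of_hasCompactSupport hscc) (fun v => hρ0 _)
      (by rw [integral_sub_left_eq_self ρ volume y, hρ1])
      (by simpa using hu₀.integrable_smul_left_of_hasCompactSupport hsc hscc) ?_
    · simpa [mul_comm] using this
    · filter_upwards [hζ0] with v hv hvρ
      obtain ⟨h5, -, h6⟩ := hρη _ hvρ
      rw [mem_closedBall_zero_iff] at hy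
      have hvL : v ∈ Metric.closedBall (0 : EuclideanSpace ℝ (Fin N)) (L + 1) := by
        rw [mem_closedBall_zero_iff]
        have := norm_sub_norm_le v y
        rw [norm_sub_rev] at this
        linarith
      have := h2 y (by rw [mem_closedBall_zero_iff]; linarith) v hvL (by rwa [dist_eq_norm])
      rw [Real.dist_eq] at this
      linarith [(abs_lt.1 this).2]
  have hev := hu.eventually_lt_spaceMollify hinit hρ hρc
    (fun y hy => hρz y (hηle.1.trans hy)) (g := fun y => ζ 0 y - ε)
    (hζ0c.sub continuous_const).continuousOn hw0 hε
  have hup : spaceMollify ρ u t x ≤ u t x + ε := by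
    have hc : Continuous fun y => u t (x - y) := huc.comp (continuous_const.sub continuous_id)
    refine integral_mul_le_of_le (g := fun y => u t (x - y)) hρi hρ0 hρ1 ?_
      (ae_of_all _ fun y hy => ?_)
    · exact (hρ.continuous.mul hc).integrable_of_hasCompactSupport
        hρc.mul_right
    · have hd : dist (x - y) x < η₁ := by
        rw [dist_eq_norm, sub_sub_cancel_left, norm_neg]
        exact (hρη y hy).2.1
      have := h1 hd
      rw [Real.dist_eq] at this
      linarith [(abs_lt.1 this).2]
  -- The cylinder starts at t₀ > 0, so small that ρ * u(t₀) almost dominates ρ * u₀ and ζ(t₀) is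
  -- within ε of ζ(0) on the ball.
  obtain ⟨t₀, hw, ht₀, ht₀'⟩ := (hev.and (Ioo_mem_nhdsGT (lt_min ht.1 hη₃))).exists
  have ht₀t : t₀ < t := ht₀'.trans_le (min_le_left _ _)
  have ht₀η : t₀ < η₃ := ht₀'.trans_le (min_le_right _ _)
  have hpos : ∀ s ∈ Icc t₀ t, 0 < s := fun s hs => ht₀.trans_le hs.1
  have key := nonpos_of_heat_ineq (z := fun s y => ζ s y - spaceMollify ρ u s y - 4 * ε)
    (t₀ := t₀) (t₁ := t) (L := L) (K := 0) ?_ ?_ ?_ ?_ t ⟨ht₀t.le, le_rfl⟩ x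
    (by rw [mem_closedBall_zero_iff]; exact hLx.le)
  · linarith
  · refine ((hζc.mono ?_).sub ((hu.continuousOn_spaceMollify hρ.continuous hρc).mono ?_)).sub
      continuousOn_const
    · exact prod_mono (Icc_subset_Icc ht₀.le ht.2) (subset_univ _)
    · exact prod_mono hpos (subset_univ _)
  · intro y hy
    have h5 := hw y hy
    have := h3 (t₀, y) ⟨⟨ht₀.le, ht₀t.le.trans ht.2⟩, hy⟩ (0, y)
      ⟨⟨le_rfl, ht.1.le.trans ht.2⟩, hy⟩ (by simpa [Prod.dist_eq, abs_of_pos ht₀] using ⟨ht₀η, hη₃⟩)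
    rw [Real.dist_eq] at this
    have := (abs_lt.1 this).2
    simp only at *
    linarith
  · intro s hs y hy
    have h5 := hL₀ s ⟨(hpos s hs).le, hs.2.trans ht.2⟩ y (by linarith)
    have h6 : 0 ≤ spaceMollify ρ u s y :=
      integral_nonneg fun v => mul_nonneg (hρ0 v) (hu.nonneg s (hpos s hs) _)
    linarith
  · intro s hs y _ _
    obtain ⟨a, d, h5, h6⟩ := hsub s ⟨ht₀.trans hs.1, hs.2.trans ht.2⟩ y
    obtain ⟨b, e, h7, h8⟩ := hu.hasHeatDerivAt_spaceMollify hρ.continuous hρc hρ0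
      (ht₀.trans hs.1) y
    refine ⟨_, _, (h5.sub h7).sub_time (hasDerivAt_const s (4 * ε)), ?_⟩
    rw [Finset.sum_sub_distrib]
    linarith

/-! ### The reaction term and its tail integral. -/

/-- The properties of the nonlinearity used in the comparison arguments. -/
structure IsConvexReaction (f : ℝ → ℝ) : Prop where
  zero : f 0 = 0
  pos : ∀ s, 0 < s → 0 < f s
  deriv_pos : ∀ s, 0 < s → 0 < deriv f s
  differentiableAt : ∀ s, 0 < s → DifferentiableAt ℝ f s
  deriv_mono : MonotoneOn (deriv f) (Ioi 0)
  continuousOn : ContinuousOn f (Ici 0)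
  tail_lt_top : ∀ s, 0 < s → tailIntegral f s < ∞

namespace IsConvexReaction

variable {f : ℝ → ℝ}

lemma nonneg (hf : IsConvexReaction f) {s : ℝ} (hs : 0 ≤ s) : 0 ≤ f s := by
  rcases hs.eq_or_lt with rfl | h
  · exact hf.zero.ge
  · exact (hf.pos s h).le

/-- By convexity, f' ≤ f'(M) on (0, M]; this is the Lipschitz bound that linearises the reaction in
the comparison argument. -/
lemma sub_le (hf : IsConvexReaction f) {M x y : ℝ} (hM : 0 < M) (hx : 0 ≤ x) (hxy : x ≤ y)
    (hy : y ≤ M) : f y - f x ≤ deriv f M * (y - x) := by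
  refine (convex_Icc 0 M).image_sub_le_mul_sub_of_deriv_le (hf.continuousOn.mono fun r hr => hr.1)
    (fun r hr => ?_) (fun r hr => ?_) x ⟨hx, hxy.trans hy⟩ y ⟨hx.trans hxy, hy⟩ hxy
  · rw [interior_Icc] at hr
    exact (hf.differentiableAt r hr.1).differentiableWithinAt
  · rw [interior_Icc] at hr
    exact hf.deriv_mono hr.1 hM hr.2.le

lemma monotoneOn (hf : IsConvexReaction f) : MonotoneOn f (Ici 0) :=
  monotoneOn_of_deriv_nonneg (convex_Ici 0) hf.continuousOn
    (fun r hr => by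
      rw [interior_Ici] at hr
      exact (hf.differentiableAt r hr).differentiableWithinAt)
    (fun r hr => by
      rw [interior_Ici] at hr
      exact (hf.deriv_pos r hr).le)

lemma continuousOn_inv (hf : IsConvexReaction f) : ContinuousOn (fun r => 1 / f r) (Ioi 0) :=
  continuousOn_const.div (hf.continuousOn.mono Ioi_subset_Ici_self) fun r hr => (hf.pos r hr).ne'

lemma integrableOn_inv (hf : IsConvexReaction f) {s : ℝ} (hs : 0 < s) :
    IntegrableOn (fun r => 1 / f r) (Ioi s) := by
  have hsub : Ioi s ⊆ Ioi 0 := Ioi_subset_Ioi hs.le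
  refine ⟨(hf.continuousOn_inv.mono hsub).aestronglyMeasurable measurableSet_Ioi, ?_⟩
  rw [hasFiniteIntegral_iff_ofReal]
  · exact hf.tail_lt_top s hs
  · filter_upwards [ae_restrict_mem measurableSet_Ioi] with r hr
    exact (one_div_pos.2 (hf.pos r (hsub hr))).le

end IsConvexReaction

/-- The real-valued tail integral. -/
noncomputable def realTail (f : ℝ → ℝ) (s : ℝ) : ℝ := ∫ r in Ioi s, 1 / f r

namespace IsConvexReaction

variable {f : ℝ → ℝ}

lemma ofReal_realTail (hf : IsConvexReaction f) {s : ℝ} (hs : 0 < s) :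
    ENNReal.ofReal (realTail f s) = tailIntegral f s := by
  refine ofReal_integral_eq_lintegral_ofReal (hf.integrableOn_inv hs) ?_
  filter_upwards [ae_restrict_mem measurableSet_Ioi] with r hr
  exact (one_div_pos.2 (hf.pos r (hs.trans hr))).le

lemma intervalIntegrable_inv (hf : IsConvexReaction f) {s t : ℝ} (hs : 0 < s) (ht : 0 < t) :
    IntervalIntegrable (fun r => 1 / f r) volume s t :=
  (hf.continuousOn_inv.mono fun _ hr => (lt_min hs ht).trans_le hr.1).intervalIntegrable

lemma realTail_eq (hf : IsConvexReaction f) {s t : ℝ} (hs : 0 < s) (ht : 0 < t) :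
    realTail f t = realTail f s - ∫ r in s..t, 1 / f r := by
  have := intervalIntegral.integral_interval_add_Ioi (hf.integrableOn_inv hs)
    (hf.integrableOn_inv ht)
  simp only [realTail]
  linarith

lemma hasDerivAt_realTail (hf : IsConvexReaction f) {s : ℝ} (hs : 0 < s) :
    HasDerivAt (realTail f) (-(1 / f s)) s := by
  have hmem : Ioi (0 : ℝ) ∈ 𝓝 s := Ioi_mem_nhds hs
  have h1 : HasDerivAt (fun t => ∫ r in s..t, 1 / f r) (1 / f s) s :=
    intervalIntegral.integral_hasDerivAt_right (hf.intervalIntegrable_inv hs hs)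
      (hf.continuousOn_inv.stronglyMeasurableAtFilter isOpen_Ioi s hs)
      (hf.continuousOn_inv.continuousAt hmem)
  refine (h1.const_sub (realTail f s)).congr_of_eventuallyEq ?_
  filter_upwards [hmem] with t ht using hf.realTail_eq hs ht

lemma continuousOn_realTail (hf : IsConvexReaction f) : ContinuousOn (realTail f) (Ioi 0) :=
  fun _ hs => (hf.hasDerivAt_realTail hs).continuousAt.continuousWithinAt

lemma strictAntiOn_realTail (hf : IsConvexReaction f) : StrictAntiOn (realTail f) (Ioi 0) := by
  refine strictAntiOn_of_deriv_neg (convex_Ioi 0) hf.continuousOn_realTail fun r hr => ?_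
  rw [interior_Ioi] at hr
  rw [(hf.hasDerivAt_realTail hr).deriv]
  exact neg_neg_of_pos (one_div_pos.2 (hf.pos r hr))

lemma tendsto_realTail_atTop (hf : IsConvexReaction f) : Tendsto (realTail f) atTop (𝓝 0) := by
  have h := intervalIntegral_tendsto_integral_Ioi 1 (hf.integrableOn_inv one_pos) tendsto_id
  have h2 := h.const_sub (realTail f 1)
  simp only [realTail, sub_self] at h2
  refine h2.congr' ?_
  filter_upwards [eventually_gt_atTop 0] with t ht
  exact (hf.realTail_eq one_pos ht).symm

/-- Since f(r) ≤ f'(1) r on (0, 1], F diverges at 0 at least logarithmically. -/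
lemma realTail_sub_log_le (hf : IsConvexReaction f) {s : ℝ} (hs : 0 < s) (hs1 : s ≤ 1) :
    realTail f 1 - Real.log s / deriv f 1 ≤ realTail f s := by
  have hc := hf.deriv_pos 1 one_pos
  have hd : ∀ r, 0 < r → HasDerivAt (fun r => realTail f r + Real.log r / deriv f 1)
      (-(1 / f r) + r⁻¹ / deriv f 1) r := fun r hr =>
    (hf.hasDerivAt_realTail hr).add ((Real.hasDerivAt_log hr.ne').div_const _)
  have hanti : AntitoneOn (fun r => realTail f r + Real.log r / deriv f 1) (Ioc 0 1) := by
    refine antitoneOn_of_deriv_nonpos (convex_Ioc 0 1)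
      (fun r hr => (hd r hr.1).continuousAt.continuousWithinAt)
      (fun r hr => (hd r (interior_subset hr).1).differentiableAt.differentiableWithinAt)
      fun r hr => ?_
    have hr := interior_subset hr
    rw [(hd r hr.1).deriv]
    have h1 := hf.sub_le one_pos le_rfl hr.1.le hr.2
    rw [hf.zero, sub_zero, sub_zero] at h1
    have : r⁻¹ / deriv f 1 = 1 / (deriv f 1 * r) := by field_simp
    rw [this]
    linarith [one_div_le_one_div_of_le (hf.pos r hr.1) h1]
  have := hanti ⟨hs, hs1⟩ ⟨one_pos, le_rfl⟩ hs1
  simp only [Real.log_one, zero_div, add_zero] at this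
  linarith

lemma tendsto_realTail_zero (hf : IsConvexReaction f) :
    Tendsto (realTail f) (𝓝[>] 0) atTop := by
  have hc := hf.deriv_pos 1 one_pos
  refine tendsto_atTop_mono' _ (f₁ := fun s => realTail f 1 - Real.log s / deriv f 1) ?_ ?_
  · filter_upwards [Ioc_mem_nhdsGT one_pos] with s hs using hf.realTail_sub_log_le hs.1 hs.2
  · have h1 : Tendsto (fun s => -Real.log s / deriv f 1) (𝓝[>] 0) atTop :=
      (tendsto_neg_atBot_atTop.comp Real.tendsto_log_nhdsGT_zero).atTop_div_const hc
    simpa [sub_eq_add_neg, neg_div] using tendsto_atTop_add_const_left _ (realTail f 1) h1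

lemma tailIntegral_zero (hf : IsConvexReaction f) : tailIntegral f 0 = ∞ := by
  refine ENNReal.eq_top_of_forall_nnreal_le fun r => ?_
  obtain ⟨s, h1, hs⟩ := ((hf.tendsto_realTail_zero.eventually_ge_atTop (r : ℝ)).and
    self_mem_nhdsWithin).exists
  calc (r : ℝ≥0∞) = ENNReal.ofReal r := by simp
    _ ≤ ENNReal.ofReal (realTail f s) := ENNReal.ofReal_le_ofReal h1
    _ = tailIntegral f s := hf.ofReal_realTail hs
    _ ≤ tailIntegral f 0 := lintegral_mono_set (Ioi_subset_Ioi (le_of_lt hs))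

/-- The function log f + f'(1) F has derivative (f' - f'(1))/f ≤ 0 on (0, 1], so it is at least its
value at 1. -/
lemma exp_le_of_le_one (hf : IsConvexReaction f) {s : ℝ} (hs : 0 < s) (hs1 : s ≤ 1) :
    f 1 * Real.exp (deriv f 1 * realTail f 1) * Real.exp (-(deriv f 1 * realTail f s)) ≤ f s := by
  have hd : ∀ r, 0 < r → HasDerivAt (fun r => Real.log (f r) + deriv f 1 * realTail f r)
      (deriv f r / f r + deriv f 1 * -(1 / f r)) r := fun r hr =>
    ((hf.differentiableAt r hr).hasDerivAt.log (hf.pos r hr).ne').add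
      ((hf.hasDerivAt_realTail hr).const_mul _)
  have hanti : AntitoneOn (fun r => Real.log (f r) + deriv f 1 * realTail f r) (Ioc 0 1) := by
    refine antitoneOn_of_deriv_nonpos (convex_Ioc 0 1)
      (fun r hr => (hd r hr.1).continuousAt.continuousWithinAt)
      (fun r hr => (hd r (interior_subset hr).1).differentiableAt.differentiableWithinAt)
      fun r hr => ?_
    have hr := interior_subset hr
    rw [(hd r hr.1).deriv]
    have h1 := hf.deriv_mono hr.1 (mem_Ioi.2 one_pos) hr.2
    have : deriv f r / f r + deriv f 1 * -(1 / f r) = (deriv f r - deriv f 1) / f r := by ring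
    rw [this]
    exact div_nonpos_of_nonpos_of_nonneg (by linarith) (hf.pos r hr.1).le
  have h := hanti ⟨hs, hs1⟩ ⟨one_pos, le_rfl⟩ hs1
  simp only at h
  calc _ = Real.exp (Real.log (f 1) + deriv f 1 * realTail f 1 - deriv f 1 * realTail f s) := by
        rw [Real.exp_sub, Real.exp_add, Real.exp_log (hf.pos 1 one_pos), Real.exp_neg]
        field_simp
    _ ≤ Real.exp (Real.log (f s)) := Real.exp_le_exp.2 (by linarith)
    _ = f s := Real.exp_log (hf.pos s hs)

end IsConvexReaction

/-! ### The inverse Φ of the tail integral. -/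

/-- `Φ` is the inverse of the tail integral of `f`. -/
structure IsTailInverse (f Φ : ℝ → ℝ) : Prop where
  pos : ∀ v, 0 < v → 0 < Φ v
  realTail_eq : ∀ v, 0 < v → realTail f (Φ v) = v

lemma IsConvexReaction.exists_isTailInverse {f : ℝ → ℝ} (hf : IsConvexReaction f) :
    ∃ Φ, IsTailInverse f Φ := by
  have : ∀ v, 0 < v → ∃ s, 0 < s ∧ realTail f s = v := fun v hv =>
    isPreconnected_Ioi.intermediate_value_Ioi
      (le_principal_iff.2 (Ioi_mem_atTop 0)) (le_principal_iff.2 self_mem_nhdsWithin)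
      hf.continuousOn_realTail hf.tendsto_realTail_atTop hf.tendsto_realTail_zero hv
  choose! Φ h1 h2 using this
  exact ⟨Φ, h1, h2⟩

namespace IsTailInverse

variable {f Φ : ℝ → ℝ}

lemma le_of_realTail_le (hΦ : IsTailInverse f Φ) (hf : IsConvexReaction f) {s v : ℝ} (hs : 0 < s)
    (hv : 0 < v) (h : realTail f s ≤ v) : Φ v ≤ s :=
  (hf.strictAntiOn_realTail.le_iff_ge hs (hΦ.pos v hv)).1 (by rwa [hΦ.realTail_eq v hv])

lemma le_of_le_realTail (hΦ : IsTailInverse f Φ) (hf : IsConvexReaction f) {s v : ℝ} (hs : 0 < s)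
    (hv : 0 < v) (h : v ≤ realTail f s) : s ≤ Φ v :=
  (hf.strictAntiOn_realTail.le_iff_ge (hΦ.pos v hv) hs).1 (by rwa [hΦ.realTail_eq v hv])

lemma strictAntiOn (hΦ : IsTailInverse f Φ) (hf : IsConvexReaction f) :
    StrictAntiOn Φ (Ioi 0) := fun v hv w hw hvw =>
  (hf.strictAntiOn_realTail.lt_iff_gt (hΦ.pos v hv) (hΦ.pos w hw)).1
    (by rwa [hΦ.realTail_eq v hv, hΦ.realTail_eq w hw])

lemma hasDerivAt (hΦ : IsTailInverse f Φ) (hf : IsConvexReaction f) {v : ℝ} (hv : 0 < v) :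
    HasDerivAt Φ (-f (Φ v)) v := by
  have hcont : ContinuousAt Φ v := by
    -- A monotone function whose image contains a neighbourhood of the value is continuous; -Φ maps
    -- (0, ∞) onto (-∞, 0).
    have hmono : MonotoneOn (fun v => -Φ v) (Ioi 0) := (hΦ.strictAntiOn hf).antitoneOn.neg
    have himg : (fun v => -Φ v) '' Ioi 0 ∈ 𝓝 (-Φ v) := by
      refine mem_of_superset (Iio_mem_nhds (neg_neg_of_pos (hΦ.pos v hv))) fun s hs => ?_
      have hs' : 0 < -s := neg_pos.2 hs
      have hpos : 0 < realTail f (-s) := by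
        have h1 := hf.strictAntiOn_realTail hs' (show (0 : ℝ) < -s + 1 by linarith) (lt_add_one _)
        have h2 : 0 ≤ realTail f (-s + 1) := by
          refine setIntegral_nonneg measurableSet_Ioi fun r hr => ?_
          exact (one_div_pos.2 (hf.pos r (by linarith [mem_Ioi.1 hr]))).le
        exact h2.trans_lt h1
      refine ⟨realTail f (-s), hpos, ?_⟩
      have := hf.strictAntiOn_realTail.injOn (hΦ.pos _ hpos) hs' (hΦ.realTail_eq _ hpos)
      simp [this]
    have h := (continuousAt_of_monotoneOn_of_image_mem_nhds hmono (Ioi_mem_nhds hv) himg).neg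
    convert h using 1
    ext
    simp
  have h := HasDerivAt.of_local_left_inverse hcont (hf.hasDerivAt_realTail (hΦ.pos v hv))
    (neg_ne_zero.2 (one_div_pos.2 (hf.pos _ (hΦ.pos v hv))).ne')
    (by filter_upwards [Ioi_mem_nhds hv] with w hw using hΦ.realTail_eq w hw)
  simpa [inv_neg] using h

lemma continuousOn (hΦ : IsTailInverse f Φ) (hf : IsConvexReaction f) : ContinuousOn Φ (Ioi 0) :=
  fun _ hv => (hΦ.hasDerivAt hf hv).continuousAt.continuousWithinAt

lemma hasDerivAt_deriv (hΦ : IsTailInverse f Φ) (hf : IsConvexReaction f) {v : ℝ} (hv : 0 < v) :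
    HasDerivAt (fun w => -f (Φ w)) (deriv f (Φ v) * f (Φ v)) v := by
  have := ((hf.differentiableAt _ (hΦ.pos v hv)).hasDerivAt.comp v (hΦ.hasDerivAt hf hv)).neg
  rw [mul_neg, neg_neg] at this
  exact this

/-- A unit increase of the argument lowers `Φ` by at least an exponentially small amount. -/
lemma exists_exp_le_sub (hΦ : IsTailInverse f Φ) (hf : IsConvexReaction f) :
    ∃ c C v₁ : ℝ, 0 < c ∧ 0 < C ∧ 0 < v₁ ∧
      ∀ v, v₁ ≤ v → C * Real.exp (-(c * v)) ≤ Φ v - Φ (v + 1) := by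
  have hc := hf.deriv_pos 1 one_pos
  refine ⟨deriv f 1, f 1 * Real.exp (deriv f 1 * realTail f 1) * Real.exp (-(deriv f 1)),
    max 1 (realTail f 1), hc, by have := hf.pos 1 one_pos; positivity, by positivity,
    fun v hv => ?_⟩
  have hv0 : 0 < v := one_pos.trans_le ((le_max_left _ _).trans hv)
  have hle : Φ (v + 1) ≤ 1 := hΦ.le_of_realTail_le hf one_pos (by linarith)
    (by linarith [(le_max_right 1 (realTail f 1)).trans hv])
  have h1 := hf.exp_le_of_le_one (hΦ.pos (v + 1) (by linarith)) hle
  rw [hΦ.realTail_eq _ (by linarith)] at h1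
  have h2 : f 1 * Real.exp (deriv f 1 * realTail f 1) * Real.exp (-(deriv f 1)) *
      Real.exp (-(deriv f 1 * v)) =
      f 1 * Real.exp (deriv f 1 * realTail f 1) * Real.exp (-(deriv f 1 * (v + 1))) := by
    rw [mul_assoc, ← Real.exp_add]
    ring_nf
  rw [h2]
  refine h1.trans ?_
  -- On [v, v + 1] the slope of Φ is -f(Φ) ≤ -f(Φ(v + 1)), so the drop is at least f(Φ(v + 1)),
  -- which `exp_le_of_le_one` bounds below.
  have h3 := (convex_Icc v (v + 1)).image_sub_le_mul_sub_of_deriv_le (f := Φ)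
    (C := -f (Φ (v + 1)))
    (fun w hw => (hΦ.hasDerivAt hf (hv0.trans_le hw.1)).continuousAt.continuousWithinAt)
    (fun w hw => (hΦ.hasDerivAt hf (hv0.trans_le
      (interior_subset hw).1)).differentiableAt.differentiableWithinAt)
    (fun w hw => ?_) v ⟨le_rfl, by linarith⟩ (v + 1) ⟨by linarith, le_rfl⟩ (by linarith)
  · linarith
  · have hw := interior_subset hw
    have hw0 := hv0.trans_le hw.1
    rw [(hΦ.hasDerivAt hf hw0).deriv]
    exact neg_le_neg (hf.monotoneOn (hΦ.pos _ (by linarith)).le (hΦ.pos w hw0).le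
      ((hΦ.strictAntiOn hf).antitoneOn hw0 (show (0 : ℝ) < v + 1 by linarith) hw.2))

end IsTailInverse

/-! ### Radial functions, Gaussians and the explicit subsolutions. -/

lemma norm_add_smul_single_sub_sq {N : ℕ} (x p : EuclideanSpace ℝ (Fin N)) (i : Fin N) (s : ℝ) :
    ‖x + s • EuclideanSpace.single i (1 : ℝ) - p‖ ^ 2 =
      ‖x - p‖ ^ 2 + 2 * (x i - p i) * s + s ^ 2 := by
  have : x + s • EuclideanSpace.single i (1 : ℝ) - p =
      (x - p) + s • EuclideanSpace.single i (1 : ℝ) := by abel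
  rw [this, norm_add_sq_real, inner_smul_right, EuclideanSpace.inner_single_right, norm_smul]
  simp
  ring

/-- Derivatives of a function depending on position only through `‖x - p‖ ^ 2`. -/
lemma hasHeatDerivAt_radial {N : ℕ} (p : EuclideanSpace ℝ (Fin N)) {G : ℝ → ℝ → ℝ} {G' : ℝ → ℝ}
    {t a g : ℝ} {x : EuclideanSpace ℝ (Fin N)}
    (ht : HasDerivAt (fun τ => G τ (‖x - p‖ ^ 2)) a t)
    (h1 : ∀ᶠ r in 𝓝 (‖x - p‖ ^ 2), HasDerivAt (G t) (G' r) r)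
    (h2 : HasDerivAt G' g (‖x - p‖ ^ 2)) :
    HasHeatDerivAt (fun τ y => G τ (‖y - p‖ ^ 2)) t x a
      (fun i => 4 * (x i - p i) ^ 2 * g + 2 * G' (‖x - p‖ ^ 2)) := by
  refine ⟨ht, fun i => ?_⟩
  simp only [norm_add_smul_single_sub_sq]
  set q := ‖x - p‖ ^ 2
  set c := x i - p i
  have hl : ∀ s, HasDerivAt (fun s : ℝ => q + 2 * c * s + s ^ 2) (2 * c + 2 * s) s := fun s => by
    exact (((hasDerivAt_id s).const_mul (2 * c)).const_add q).add ((hasDerivAt_id s).pow 2)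
      |>.congr_deriv (by simp)
  have hl0 : q + 2 * c * 0 + (0 : ℝ) ^ 2 = q := by ring
  refine ⟨fun s => G' (q + 2 * c * s + s ^ 2) * (2 * c + 2 * s), ?_, ?_⟩
  · have hcont : Tendsto (fun s : ℝ => q + 2 * c * s + s ^ 2) (𝓝 0) (𝓝 q) := by
      have := (hl 0).continuousAt.tendsto
      rwa [hl0] at this
    filter_upwards [hcont.eventually h1] with s hs
    exact hs.comp s (hl s)
  · have h3 : HasDerivAt (fun s : ℝ => 2 * c + 2 * s) 2 0 := by
      simpa using ((hasDerivAt_id (0 : ℝ)).const_mul 2).const_add (2 * c)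
    have h4 : HasDerivAt (fun s : ℝ => G' (q + 2 * c * s + s ^ 2)) (g * (2 * c + 2 * 0)) 0 :=
      HasDerivAt.comp (0 : ℝ) (by rw [hl0]; exact h2) (hl 0)
    refine (h4.mul h3).congr_deriv ?_
    rw [hl0]
    ring

lemma sum_radial {N : ℕ} (x p : EuclideanSpace ℝ (Fin N)) (g g' : ℝ) :
    ∑ i, (4 * (x i - p i) ^ 2 * g + 2 * g') = 4 * ‖x - p‖ ^ 2 * g + 2 * N * g' := by
  rw [Finset.sum_add_distrib, ← Finset.sum_mul, ← Finset.mul_sum, EuclideanSpace.real_norm_sq_eq]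
  simp
  ring

/-- The Gaussian `s ^ (-N / 2) * exp (-‖x - p‖ ^ 2 / (4 s))` with `s = t + σ`. -/
noncomputable def shiftedGaussian {N : ℕ} (σ : ℝ) (p : EuclideanSpace ℝ (Fin N)) (t : ℝ)
    (x : EuclideanSpace ℝ (Fin N)) : ℝ :=
  Real.exp (-(‖x - p‖ ^ 2 / (4 * (t + σ))) - N / 2 * Real.log (t + σ))

lemma hasHeatDerivAt_shiftedGaussian {N : ℕ} {σ t : ℝ} (h : 0 < t + σ)
    (p x : EuclideanSpace ℝ (Fin N)) :
    ∃ a d, HasHeatDerivAt (shiftedGaussian σ p) t x a d ∧ a = ∑ i, d i := by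
  set E : ℝ → ℝ → ℝ := fun τ r => Real.exp (-(r / (4 * (τ + σ))) - N / 2 * Real.log (τ + σ)) with hE
  have hr : ∀ r, HasDerivAt (E t) (E t r * -(1 / (4 * (t + σ)))) r := fun r =>
    ((((hasDerivAt_id r).div_const _).neg).sub_const _).exp
  have ht : ∀ r, HasDerivAt (fun τ => E τ r)
      (E t r * (r / (4 * (t + σ) ^ 2) - N / 2 * (1 / (t + σ)))) t := fun r => by
    have h1 : HasDerivAt (fun τ => τ + σ) 1 t := (hasDerivAt_id t).add_const σ
    have h2 := ((((hasDerivAt_const t r).div (h1.const_mul 4) (by positivity)).neg).sub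
      ((h1.log h.ne').const_mul (N / 2 : ℝ))).exp
    refine h2.congr_deriv ?_
    change E t r * _ = _
    congr 1
    field_simp
    ring
  refine ⟨_, _, hasHeatDerivAt_radial (G := E) p (ht _) (Eventually.of_forall hr)
    ((hr _).mul_const _), ?_⟩
  rw [sum_radial]
  field_simp
  ring

lemma continuousOn_shiftedGaussian {N : ℕ} {σ : ℝ} (hσ : 0 < σ) (p : EuclideanSpace ℝ (Fin N)) :
    ContinuousOn (fun q : ℝ × EuclideanSpace ℝ (Fin N) => shiftedGaussian σ p q.1 q.2)
      (Ici 0 ×ˢ univ) := by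
  have h : ∀ q ∈ Ici (0 : ℝ) ×ˢ (univ : Set (EuclideanSpace ℝ (Fin N))), 0 < q.1 + σ :=
    fun q hq => add_pos_of_nonneg_of_pos hq.1 hσ
  refine Real.continuous_exp.comp_continuousOn (ContinuousOn.sub ?_ ?_)
  · exact (ContinuousOn.div (by fun_prop) (by fun_prop)
      fun q hq => (mul_pos four_pos (h q hq)).ne').neg
  · exact continuousOn_const.mul (ContinuousOn.log (by fun_prop) fun q hq => (h q hq).ne')

/-- The radial Laplacian is 4b²|x|² f'(Φ) f(Φ) - 2Nb f(Φ); dropping the nonnegative first term gives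
the inequality. -/
lemma IsTailInverse.exists_hasHeatDerivAt {f Φ : ℝ → ℝ} (hΦ : IsTailInverse f Φ)
    (hf : IsConvexReaction f) {N : ℕ} {A κ b t : ℝ} (x : EuclideanSpace ℝ (Fin N))
    (hV : 0 < A + κ * t + b * ‖x‖ ^ 2) :
    ∃ a d, HasHeatDerivAt (fun τ y => Φ (A + κ * τ + b * ‖y‖ ^ 2)) t x a d ∧
      a ≤ ∑ i, d i + (2 * N * b - κ) * f (Φ (A + κ * t + b * ‖x‖ ^ 2)) := by
  have hr : ∀ r, HasDerivAt (fun r => A + κ * t + b * r) b r := fun r => by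
    simpa using ((hasDerivAt_id r).const_mul b).const_add (A + κ * t)
  have hτ : HasDerivAt (fun τ => A + κ * τ + b * ‖x‖ ^ 2) κ t := by
    simpa using (((hasDerivAt_id t).const_mul κ).const_add A).add_const (b * ‖x‖ ^ 2)
  have key := hasHeatDerivAt_radial (0 : EuclideanSpace ℝ (Fin N)) (x := x) (t := t)
    (G := fun τ r => Φ (A + κ * τ + b * r))
    (G' := fun r => -f (Φ (A + κ * t + b * r)) * b)
    (by
      rw [sub_zero]
      exact (hΦ.hasDerivAt hf hV).comp t hτ)
    (by
      have hcont : ContinuousAt (fun r => A + κ * t + b * r) (‖x - 0‖ ^ 2) :=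
        (hr _).continuousAt
      filter_upwards [hcont.eventually (lt_mem_nhds (by simpa using hV))] with r h
      exact (hΦ.hasDerivAt hf h).comp r (hr r))
    (HasDerivAt.mul_const (HasDerivAt.comp (‖x - 0‖ ^ 2) (h := fun r => A + κ * t + b * r)
      (hΦ.hasDerivAt_deriv hf (by simpa using hV)) (hr _)) b)
  simp only [sub_zero] at key
  refine ⟨_, _, key, ?_⟩
  have := sum_radial x 0 (deriv f (Φ (A + κ * t + b * ‖x‖ ^ 2)) *
    f (Φ (A + κ * t + b * ‖x‖ ^ 2)) * b * b) (-f (Φ (A + κ * t + b * ‖x‖ ^ 2)) * b)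
  simp only [sub_zero] at this
  rw [this]
  have h1 := hf.deriv_pos _ (hΦ.pos _ hV)
  have h2 := hf.pos _ (hΦ.pos _ hV)
  have : 0 ≤ 4 * ‖x‖ ^ 2 * (deriv f (Φ (A + κ * t + b * ‖x‖ ^ 2)) *
    f (Φ (A + κ * t + b * ‖x‖ ^ 2)) * b * b) := by
    have : 0 ≤ b * b := mul_self_nonneg b
    rw [mul_assoc _ b b]
    positivity
  linarith

lemma IsTailInverse.exists_forall_le {f Φ : ℝ → ℝ} (hΦ : IsTailInverse f Φ)
    (hf : IsConvexReaction f) {b ε : ℝ} (hb : 0 < b) (hε : 0 < ε) :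
    ∃ L, 0 < L ∧ ∀ r V, L ≤ r → b * r ^ 2 ≤ V → Φ V ≤ ε := by
  refine ⟨max 1 (realTail f ε / b), by positivity, fun r V hr hV => ?_⟩
  have h1 : 1 ≤ r := (le_max_left _ _).trans hr
  have h2 : realTail f ε ≤ r * b := (div_le_iff₀ hb).1 ((le_max_right _ _).trans hr)
  have h3 : b * r ≤ b * r ^ 2 := by nlinarith [mul_nonneg hb.le (sub_nonneg.2 h1)]
  exact hΦ.le_of_realTail_le hf hε (by nlinarith) (by linarith)

lemma IsTailInverse.continuousOn_comp {f Φ : ℝ → ℝ} (hΦ : IsTailInverse f Φ)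
    (hf : IsConvexReaction f) {N : ℕ} {A κ b : ℝ} {S : Set (ℝ × EuclideanSpace ℝ (Fin N))}
    (hS : ∀ p ∈ S, 0 < A + κ * p.1 + b * ‖p.2‖ ^ 2) :
    ContinuousOn (fun p : ℝ × EuclideanSpace ℝ (Fin N) => Φ (A + κ * p.1 + b * ‖p.2‖ ^ 2)) S :=
  (hΦ.continuousOn hf).comp (f := fun p : ℝ × EuclideanSpace ℝ (Fin N) =>
    A + κ * p.1 + b * ‖p.2‖ ^ 2) (by fun_prop) hS

/-! ### Lower bounds at positive times. -/

/-- Lower bound outside a large ball after a short time. -/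
lemma IsHeatSupersolution.exists_tail_lower_bound {N : ℕ} {f Φ : ℝ → ℝ}
    (hΦ : IsTailInverse f Φ) (hf : IsConvexReaction f)
    {u : ℝ → EuclideanSpace ℝ (Fin N) → ℝ} {u₀ : EuclideanSpace ℝ (Fin N) → ℝ}
    (hu : IsHeatSupersolution u)
    (hinit : ∀ φ : EuclideanSpace ℝ (Fin N) → ℝ, Continuous φ → HasCompactSupport φ →
      Tendsto (fun t => ∫ x, u t x * φ x) (𝓝[>] 0) (𝓝 (∫ x, u₀ x * φ x)))
    (hu₀ : LocallyIntegrable u₀) (hu₀0 : ∀ᵐ x, 0 ≤ u₀ x) {b R : ℝ} (hb : 0 < b) (hR : 0 < R)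
    (hlow : ∀ᵐ x, R ≤ ‖x‖ → Φ (b * ‖x‖ ^ 2) ≤ u₀ x) :
    ∃ τ A R₁ : ℝ, 0 < τ ∧ 0 < A ∧ ∀ x, R₁ ≤ ‖x‖ → Φ (A + b * ‖x‖ ^ 2) ≤ u τ x := by
  obtain ⟨c, C, v₁, hc, hC, hv₁, hexp⟩ := hΦ.exists_exp_le_sub hf
  have hanti := (hΦ.strictAntiOn hf).antitoneOn
  -- At time σ the Gaussian decays like exp(-2cb|x|²), twice the rate in exp(-c(v₀ + b|x|²)), so it
  -- loses for large |x|.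
  set σ := 1 / (16 * c * b) with hσ
  have hσ0 : 0 < σ := by positivity
  -- Chosen so that M times the initial Gaussian is at least Φ 1 on the ball of radius R, which
  -- makes ζ(0) ≤ 0 there.
  set M := Φ 1 * Real.exp (R ^ 2 / (4 * σ) + N / 2 * Real.log σ) with hM
  have hM0 : 0 < M := mul_pos (hΦ.pos 1 one_pos) (Real.exp_pos _)
  have hVpos : ∀ t ∈ Icc 0 σ, ∀ x : EuclideanSpace ℝ (Fin N),
      1 ≤ 1 + 2 * N * b * t + b * ‖x‖ ^ 2 := by
    intro t ht x
    have := ht.1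
    have : 0 ≤ 2 * N * b * t + b * ‖x‖ ^ 2 := by positivity
    linarith
  have key := hu.ge_of_subsolution hinit hu₀ (τ := σ)
    (ζ := fun t x => Φ (1 + 2 * N * b * t + b * ‖x‖ ^ 2) - M * shiftedGaussian σ 0 t x)
    ?_ ?_ ?_ ?_ σ ⟨hσ0, le_rfl⟩
  · have h2σ : 1 / (4 * (σ + σ)) = 2 * (c * b) := by
      rw [hσ]
      field_simp
      norm_num
    set v₀ := 1 + 2 * N * b * σ with hv₀
    have hv₀0 : 0 < v₀ := by positivity
    set Q := M * Real.exp (-(N / 2 * Real.log (σ + σ))) * Real.exp (c * v₀) / C with hQ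
    have hQ0 : 0 < Q := by positivity
    refine ⟨σ, v₀ + 1, max 1 (max (Q / (c * b)) (v₁ / b)), hσ0, by linarith, fun x hx => ?_⟩
    obtain ⟨h1, h2, h3⟩ : 1 ≤ ‖x‖ ∧ Q / (c * b) ≤ ‖x‖ ∧ v₁ / b ≤ ‖x‖ := by simpa using hx
    have hsq : ‖x‖ ≤ ‖x‖ ^ 2 := by nlinarith
    have hv₁x : v₁ ≤ v₀ + b * ‖x‖ ^ 2 := by
      rw [div_le_iff₀ hb] at h3
      nlinarith
    have h4 := hexp _ hv₁x
    have h5 := key x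
    have hQx : Q ≤ Real.exp (c * b * ‖x‖ ^ 2) := by
      rw [div_le_iff₀ (by positivity)] at h2
      have := Real.add_one_le_exp (c * b * ‖x‖ ^ 2)
      have : ‖x‖ * (c * b) ≤ c * b * ‖x‖ ^ 2 := by
        rw [mul_comm]
        exact mul_le_mul_of_nonneg_left hsq (by positivity)
      linarith
    have h6 : M * shiftedGaussian σ 0 σ x ≤ C * Real.exp (-(c * (v₀ + b * ‖x‖ ^ 2))) := by
      have hg : shiftedGaussian σ 0 σ x = Real.exp (-(N / 2 * Real.log (σ + σ))) *
          Real.exp (-(2 * (c * b) * ‖x‖ ^ 2)) := by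
        rw [shiftedGaussian, ← Real.exp_add, ← h2σ, sub_zero]
        ring_nf
      have h7 : M * shiftedGaussian σ 0 σ x =
          C * (Q * Real.exp (-(c * v₀) - 2 * (c * b) * ‖x‖ ^ 2)) := by
        rw [hg, sub_eq_add_neg, Real.exp_add, Real.exp_neg (c * v₀), hQ]
        field_simp
      rw [h7]
      refine mul_le_mul_of_nonneg_left ?_ hC.le
      calc _ ≤ Real.exp (c * b * ‖x‖ ^ 2) * Real.exp (-(c * v₀) - 2 * (c * b) * ‖x‖ ^ 2) :=
            mul_le_mul_of_nonneg_right hQx (Real.exp_pos _).le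
        _ = _ := by
          rw [← Real.exp_add]
          ring_nf
    have h8 : v₀ + 1 + b * ‖x‖ ^ 2 = v₀ + b * ‖x‖ ^ 2 + 1 := by ring
    rw [h8]
    linarith
  · refine ContinuousOn.sub (hΦ.continuousOn_comp hf fun p hp => ?_) (continuousOn_const.mul
      ((continuousOn_shiftedGaussian hσ0 0).mono (prod_mono_left Icc_subset_Ici_self)))
    exact one_pos.trans_le (hVpos p.1 hp.1 p.2)
  · filter_upwards [hu₀0, hlow] with x hx0 hx
    have hGpos : 0 < M * shiftedGaussian σ 0 0 x := mul_pos hM0 (Real.exp_pos _)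
    have h1 := hVpos 0 ⟨le_rfl, hσ0.le⟩ x
    by_cases hxR : R ≤ ‖x‖
    · have hbx : 0 < b * ‖x‖ ^ 2 := by have := hR.trans_le hxR; positivity
      have := hanti hbx (one_pos.trans_le h1)
        (by linarith : b * ‖x‖ ^ 2 ≤ 1 + 2 * N * b * 0 + b * ‖x‖ ^ 2)
      linarith [hx hxR]
    · have h2 := hanti (mem_Ioi.2 one_pos) (one_pos.trans_le h1) h1
      have h3 : Φ 1 ≤ M * shiftedGaussian σ 0 0 x := by
        rw [hM, shiftedGaussian, mul_assoc, ← Real.exp_add, sub_zero, zero_add]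
        refine le_mul_of_one_le_right (hΦ.pos 1 one_pos).le (Real.one_le_exp ?_)
        have : ‖x‖ ^ 2 / (4 * σ) ≤ R ^ 2 / (4 * σ) := by
          have := (not_le.1 hxR).le
          gcongr
        linarith
      linarith
  · intro ε hε
    obtain ⟨L, -, hL⟩ := hΦ.exists_forall_le hf hb hε
    refine ⟨L, fun t ht x hx => ?_⟩
    have h0 := ht.1
    have := hL ‖x‖ (1 + 2 * N * b * t + b * ‖x‖ ^ 2) hx (by
      have : 0 ≤ 2 * N * b * t := by positivity
      linarith)
    have hGpos : 0 < M * shiftedGaussian σ 0 t x := mul_pos hM0 (Real.exp_pos _)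
    linarith
  · intro t ht x
    obtain ⟨a, d, h1, h2⟩ := hΦ.exists_hasHeatDerivAt hf (A := 1) (κ := 2 * N * b) (b := b) (t := t)
      x (one_pos.trans_le (hVpos t ⟨ht.1.le, ht.2⟩ x))
    obtain ⟨a', d', h3, h4⟩ := hasHeatDerivAt_shiftedGaussian (add_pos ht.1 hσ0) 0 x
    refine ⟨_, _, h1.sub (h3.const_mul M), ?_⟩
    rw [Finset.sum_sub_distrib, ← Finset.mul_sum, ← h4]
    linarith

/-- A nonnegative supersolution whose initial value is positive on a ball is positive. -/
lemma IsHeatSupersolution.pos {N : ℕ}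
    {u : ℝ → EuclideanSpace ℝ (Fin N) → ℝ} {u₀ : EuclideanSpace ℝ (Fin N) → ℝ}
    (hu : IsHeatSupersolution u)
    (hinit : ∀ φ : EuclideanSpace ℝ (Fin N) → ℝ, Continuous φ → HasCompactSupport φ →
      Tendsto (fun t => ∫ x, u t x * φ x) (𝓝[>] 0) (𝓝 (∫ x, u₀ x * φ x)))
    (hu₀ : LocallyIntegrable u₀) (hu₀0 : ∀ᵐ x, 0 ≤ u₀ x) {p : EuclideanSpace ℝ (Fin N)} {δ : ℝ}
    (hδ : 0 < δ) (hlow : ∀ᵐ x, ‖x - p‖ ≤ 1 → δ ≤ u₀ x) {t : ℝ} (ht : 0 < t)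
    (x : EuclideanSpace ℝ (Fin N)) : 0 < u t x := by
  -- exp(-D) bounds the Gaussian at (t, x) from below, while k below is its initial value on the
  -- unit sphere about p. The choice of m makes σ small enough that k < exp(-D).
  set D := ‖x - p‖ ^ 2 / (4 * t) + N / 2 * |Real.log (t + 1)| with hD
  have hD0 : 0 ≤ D := by positivity
  set m : ℝ := 4 * N + 4 * (D + 1) with hm
  have hm4 : 4 ≤ m := by
    have : (0 : ℝ) ≤ 4 * N := by positivity
    linarith
  set σ := 1 / m ^ 2 with hσ
  have hσ0 : 0 < σ := by positivity
  have hσ1 : σ ≤ 1 := by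
    rw [hσ, div_le_one (by positivity)]
    nlinarith
  have hlog : Real.log σ = -(2 * Real.log m) := by
    rw [hσ, one_div, Real.log_inv, Real.log_pow]
    norm_num
  have hbig : D + 1 ≤ 1 / (4 * σ) + N / 2 * Real.log σ := by
    have h1 : 1 / (4 * σ) = m ^ 2 / 4 := by
      rw [hσ]
      field_simp
    have h2 : Real.log m ≤ m := (Real.log_le_sub_one_of_pos (by linarith)).trans (by linarith)
    have h3 : (N : ℝ) * Real.log m ≤ N * m := mul_le_mul_of_nonneg_left h2 (by positivity)
    have h4 : m ^ 2 / 4 - N * m = m * (D + 1) := by rw [hm]; ring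
    rw [h1, hlog]
    nlinarith
  set k := Real.exp (-(1 / (4 * σ)) - N / 2 * Real.log σ) with hk
  have hk0 : 0 < k := Real.exp_pos _
  -- Normalised so that c times the initial Gaussian peaks at δ; then c(G - k) is at most δ in the
  -- unit ball about p and at most 0 outside.
  set c := δ * Real.exp (N / 2 * Real.log σ) with hc
  have hc0 : 0 < c := mul_pos hδ (Real.exp_pos _)
  have key := hu.ge_of_subsolution hinit hu₀ (τ := t)
    (ζ := fun s y => c * shiftedGaussian σ p s y - c * k) ?_ ?_ ?_ ?_ t ⟨ht, le_rfl⟩ x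
  · refine lt_of_lt_of_le ?_ key
    have : k < shiftedGaussian σ p t x := by
      refine Real.exp_lt_exp.2 ?_
      have h1 : ‖x - p‖ ^ 2 / (4 * (t + σ)) ≤ ‖x - p‖ ^ 2 / (4 * t) := by
        gcongr
        linarith
      have h2 : Real.log (t + σ) ≤ |Real.log (t + 1)| :=
        (Real.log_le_log (by positivity) (by linarith)).trans (le_abs_self _)
      have h3 : (N / 2 : ℝ) * Real.log (t + σ) ≤ N / 2 * |Real.log (t + 1)| :=
        mul_le_mul_of_nonneg_left h2 (by positivity)
      linarith
    have := mul_lt_mul_of_pos_left this hc0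
    linarith
  · exact (continuousOn_const.mul ((continuousOn_shiftedGaussian hσ0 p).mono
      (prod_mono_left Icc_subset_Ici_self))).sub continuousOn_const
  · filter_upwards [hu₀0, hlow] with y hy0 hy
    by_cases hyp : ‖y - p‖ ≤ 1
    · have h1 : shiftedGaussian σ p 0 y ≤ Real.exp (-(N / 2 * Real.log σ)) := by
        refine Real.exp_le_exp.2 ?_
        rw [zero_add]
        have : 0 ≤ ‖y - p‖ ^ 2 / (4 * σ) := by positivity
        linarith
      have h2 := mul_le_mul_of_nonneg_left h1 hc0.le
      have h3 : c * Real.exp (-(N / 2 * Real.log σ)) = δ := by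
        rw [hc, mul_assoc, ← Real.exp_add, add_neg_cancel, Real.exp_zero, mul_one]
      have := mul_pos hc0 hk0
      linarith [hy hyp]
    · have h1 : shiftedGaussian σ p 0 y ≤ k := by
        refine Real.exp_le_exp.2 ?_
        rw [zero_add]
        have : 1 / (4 * σ) ≤ ‖y - p‖ ^ 2 / (4 * σ) := by
          have : 1 ≤ ‖y - p‖ ^ 2 := one_le_pow₀ (not_le.1 hyp).le
          gcongr
        linarith
      have h2 := mul_le_mul_of_nonneg_left h1 hc0.le
      linarith
  · intro ε hε
    set W := 4 * (t + σ) * (1 / (4 * σ)) with hW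
    have hW0 : 0 < W := by positivity
    refine ⟨‖p‖ + max 1 W, fun s hs y hy => ?_⟩
    have hs0 := hs.1
    have h1 : shiftedGaussian σ p s y ≤ k := by
      refine Real.exp_le_exp.2 ?_
      have h3 : max 1 W ≤ ‖y - p‖ := by linarith [norm_sub_norm_le y p]
      have h4 : 1 ≤ ‖y - p‖ := (le_max_left _ _).trans h3
      have h5 : W ≤ ‖y - p‖ ^ 2 := by
        nlinarith [(le_max_right 1 W).trans h3]
      have h6 : 1 / (4 * σ) ≤ ‖y - p‖ ^ 2 / (4 * (s + σ)) := by
        rw [le_div_iff₀ (by positivity)]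
        refine le_trans ?_ h5
        rw [hW, mul_comm]
        have := hs.2
        gcongr
      have h7 : Real.log σ ≤ Real.log (s + σ) := Real.log_le_log hσ0 (by linarith)
      have h8 : (N / 2 : ℝ) * Real.log σ ≤ N / 2 * Real.log (s + σ) :=
        mul_le_mul_of_nonneg_left h7 (by positivity)
      linarith
    have := mul_le_mul_of_nonneg_left h1 hc0.le
    linarith
  · intro s hs y
    obtain ⟨a, d, h1, h2⟩ := hasHeatDerivAt_shiftedGaussian (add_pos hs.1 hσ0) p y
    refine ⟨_, _, (h1.const_mul c).sub_time (hasDerivAt_const s (c * k)), ?_⟩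
    rw [← Finset.mul_sum, ← h2, sub_zero]

/-! ### Nonlinear comparison and blow-up. -/

lemma IsGlobalSolution.isHeatSupersolution {N : ℕ} {f : ℝ → ℝ} (hf : IsConvexReaction f)
    {u₀ : EuclideanSpace ℝ (Fin N) → ℝ} {u : ℝ → EuclideanSpace ℝ (Fin N) → ℝ}
    (hu : IsGlobalSolution f u₀ u) : IsHeatSupersolution u where
  isC21 := hu.isC21
  nonneg := hu.nonneg
  laplacian_le t ht x := by
    rw [hu.equation t ht x]
    linarith [hf.nonneg (hu.nonneg t ht x)]

/-- Comparison of a global solution with the explicit subsolution `Φ (A + κ t + b ‖x‖ ^ 2)`,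
`κ = 2 N b - 1`, whose argument vanishes in finite time. -/
lemma IsGlobalSolution.ge_explicit_subsolution {N : ℕ} {f Φ : ℝ → ℝ} (hΦ : IsTailInverse f Φ)
    (hf : IsConvexReaction f) {u₀ : EuclideanSpace ℝ (Fin N) → ℝ}
    {u : ℝ → EuclideanSpace ℝ (Fin N) → ℝ} (hu : IsGlobalSolution f u₀ u) {A b κ τ t₁ : ℝ}
    (hb : 0 < b) (hκ : κ = 2 * N * b - 1) (hκ0 : κ ≤ 0) (hτ : 0 < τ) (hτ₁ : τ ≤ t₁)
    (hA : 0 < A + κ * t₁) (hlow : ∀ x, Φ (A + κ * τ + b * ‖x‖ ^ 2) ≤ u τ x)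
    (x : EuclideanSpace ℝ (Fin N)) : Φ (A + κ * t₁ + b * ‖x‖ ^ 2) ≤ u t₁ x := by
  have hanti := (hΦ.strictAntiOn hf).antitoneOn
  have hVge : ∀ t ∈ Icc τ t₁, ∀ y : EuclideanSpace ℝ (Fin N),
      A + κ * t₁ + b * ‖y‖ ^ 2 ≤ A + κ * t + b * ‖y‖ ^ 2 := fun t ht y => by
    have := mul_le_mul_of_nonpos_left ht.2 hκ0
    linarith
  have hVpos : ∀ t ∈ Icc τ t₁, ∀ y : EuclideanSpace ℝ (Fin N),
      0 < A + κ * t + b * ‖y‖ ^ 2 := fun t ht y => by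
    have h1 := hVge t ht y
    have : 0 ≤ b * ‖y‖ ^ 2 := by positivity
    linarith
  -- As κ ≤ 0, the argument is smallest at t₁ and x = 0, so M bounds the subsolution. Where u lies
  -- below it, f is Lipschitz with constant K = f'(M), and the term ε exp(K(t - τ)) absorbs the
  -- resulting growth.
  set M := Φ (A + κ * t₁) with hM
  have hM0 : 0 < M := hΦ.pos _ hA
  have hζM : ∀ t ∈ Icc τ t₁, ∀ y : EuclideanSpace ℝ (Fin N),
      Φ (A + κ * t + b * ‖y‖ ^ 2) ≤ M := fun t ht y => by
    refine hanti hA (hVpos t ht y) ?_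
    have h1 := hVge t ht y
    have : 0 ≤ b * ‖y‖ ^ 2 := by positivity
    linarith
  set K := deriv f M with hK
  have hK0 : 0 < K := hf.deriv_pos M hM0
  refine le_of_forall_pos_le_add fun δ hδ => ?_
  set E₁ := Real.exp (K * (t₁ - τ)) with hE₁
  have hE₁0 : 0 < E₁ := Real.exp_pos _
  set ε := δ / E₁ with hε
  have hε0 : 0 < ε := div_pos hδ hE₁0
  obtain ⟨L₀, -, hL₀⟩ := hΦ.exists_forall_le hf hb hε0
  set L := max L₀ ‖x‖ with hL
  have hpos : ∀ t ∈ Icc τ t₁, 0 < t := fun t ht => hτ.trans_le ht.1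
  have key := nonpos_of_heat_ineq (t₀ := τ) (t₁ := t₁) (L := L) (K := K)
    (z := fun t y => Φ (A + κ * t + b * ‖y‖ ^ 2) - u t y - ε * Real.exp (K * (t - τ)))
    ?_ ?_ ?_ ?_ t₁ ⟨hτ₁, le_rfl⟩ x (by rw [mem_closedBall_zero_iff]; exact le_max_right _ _)
  · have : ε * E₁ = δ := div_mul_cancel₀ _ hE₁0.ne'
    simp only [← hE₁] at key
    linarith
  · refine ((hΦ.continuousOn_comp hf fun p hp => hVpos p.1 hp.1 p.2).sub
      (hu.isC21.continuousOn.mono (prod_mono hpos (subset_univ _)))).sub ?_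
    exact Continuous.continuousOn (by fun_prop)
  · intro y _
    have := hlow y
    simp only [sub_self, mul_zero, Real.exp_zero, mul_one]
    linarith
  · intro t ht y hy
    have h1 : Φ (A + κ * t + b * ‖y‖ ^ 2) ≤ ε := hL₀ ‖y‖ _ (hy ▸ le_max_left _ _) (by
      have := hVge t ht y
      linarith)
    have h2 := hu.nonneg t (hpos t ht) y
    have h3 : 1 ≤ Real.exp (K * (t - τ)) :=
      Real.one_le_exp (mul_nonneg hK0.le (by linarith [ht.1]))
    have h4 : ε ≤ ε * Real.exp (K * (t - τ)) := le_mul_of_one_le_right hε0.le h3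
    linarith
  · intro t ht y _ hz
    have htI : t ∈ Icc τ t₁ := ⟨ht.1.le, ht.2⟩
    have ht0 := hpos t htI
    obtain ⟨a, d, h1, h2⟩ := hΦ.exists_hasHeatDerivAt hf (κ := κ) y (hVpos t htI y)
    have hexp : HasDerivAt (fun s => ε * Real.exp (K * (s - τ)))
        (ε * (Real.exp (K * (t - τ)) * K)) t := by
      refine HasDerivAt.const_mul ε ?_
      simpa using (((hasDerivAt_id t).sub_const τ).const_mul K).exp
    refine ⟨_, _, (h1.sub (hu.isC21.hasHeatDerivAt ht0 y)).sub_time hexp, ?_⟩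
    rw [Finset.sum_sub_distrib, ← laplacian_eq_sum_fderiv, hu.equation t ht0 y]
    have hE : 0 < ε * Real.exp (K * (t - τ)) := mul_pos hε0 (Real.exp_pos _)
    have hcoef : 2 * N * b - κ = 1 := by rw [hκ]; ring
    rw [hcoef, one_mul] at h2
    have h3 := hf.sub_le hM0 (hu.nonneg t ht0 y)
      (by linarith : u t y ≤ Φ (A + κ * t + b * ‖y‖ ^ 2)) (hζM t htI y)
    rw [← hK] at h3
    linarith

/-- A global solution cannot lie above the explicit subsolution at a positive time. -/
lemma IsGlobalSolution.false_of_lower_bound {N : ℕ} {f Φ : ℝ → ℝ} (hΦ : IsTailInverse f Φ)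
    (hf : IsConvexReaction f) {u₀ : EuclideanSpace ℝ (Fin N) → ℝ}
    {u : ℝ → EuclideanSpace ℝ (Fin N) → ℝ} (hu : IsGlobalSolution f u₀ u) {A b τ : ℝ}
    (hb : 0 < b) (hNb : 2 * N * b < 1) (hτ : 0 < τ) (hA : 0 < A)
    (hlow : ∀ x, Φ (A + b * ‖x‖ ^ 2) ≤ u τ x) : False := by
  obtain ⟨k, hk⟩ : ∃ k, k = 1 - 2 * N * b := ⟨_, rfl⟩
  have hk0 : 0 < k := by linarith
  -- The time at which the argument A + kτ - kt of the subsolution at the origin vanishes. Just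
  -- before T, Φ exceeds u(T, 0) + 1, contradicting continuity of u at T.
  set T := τ + A / k with hT
  have hτT : τ < T := by
    have : 0 < A / k := div_pos hA hk0
    linarith
  have hkT : A + k * τ - k * T = 0 := by
    rw [hT]
    field_simp
    ring
  set s := u T 0 + 1 with hs
  have hs0 : 0 < s := by linarith [hu.nonneg T (hτ.trans hτT) 0]
  have hFpos : 0 < realTail f s := by
    by_contra! h
    have h1 := hf.strictAntiOn_realTail hs0 (show (0 : ℝ) < s + 1 by linarith) (lt_add_one _)
    have h2 : 0 ≤ realTail f (s + 1) := by
      refine setIntegral_nonneg measurableSet_Ioi fun r hr => ?_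
      exact (one_div_pos.2 (hf.pos r (by linarith [mem_Ioi.1 hr]))).le
    linarith
  have hcont : Tendsto (fun t => u t 0) (𝓝[<] T) (𝓝 (u T 0)) :=
    ((hu.isC21.differentiableAt_time T (hτ.trans hτT) 0).continuousAt.tendsto).mono_left
      nhdsWithin_le_nhds
  have hge : ∀ᶠ t in 𝓝[<] T, s ≤ u t 0 := by
    have hδ : max τ (T - realTail f s / k) < T :=
      max_lt hτT (by linarith [div_pos hFpos hk0])
    filter_upwards [Ioo_mem_nhdsLT hδ] with t ht
    obtain ⟨h1, h2⟩ := max_lt_iff.1 ht.1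
    have h3 : 0 < (A + k * τ) + (-k) * t := by
      have := mul_lt_mul_of_pos_left ht.2 hk0
      linarith
    have h4 := hu.ge_explicit_subsolution hΦ hf (A := A + k * τ) (κ := -k) (t₁ := t) hb
      (by linarith) (by linarith) hτ h1.le h3 (fun x => by
        have : A + k * τ + -k * τ = A := by ring
        rw [this]
        exact hlow x) 0
    refine le_trans ?_ h4
    simp only [norm_zero, ne_eq, OfNat.ofNat_ne_zero, not_false_eq_true, zero_pow, mul_zero,
      add_zero]
    refine hΦ.le_of_le_realTail hf hs0 h3 ?_
    have h5 : T - t < realTail f s / k := by linarith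
    rw [lt_div_iff₀ hk0] at h5
    linarith
  have := ge_of_tendsto hcont hge
  linarith

lemma IsGlobalSolution.exists_lower_bound {N : ℕ} (hN : 1 ≤ N) {f Φ : ℝ → ℝ}
    (hΦ : IsTailInverse f Φ) (hf : IsConvexReaction f) {u₀ : EuclideanSpace ℝ (Fin N) → ℝ}
    {u : ℝ → EuclideanSpace ℝ (Fin N) → ℝ} (hu : IsGlobalSolution f u₀ u)
    (hu₀ : LocallyIntegrable u₀) (hu₀0 : ∀ᵐ x, 0 ≤ u₀ x) {b R : ℝ} (hb : 0 < b) (hR : 0 < R)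
    (hlow : ∀ᵐ x, R ≤ ‖x‖ → Φ (b * ‖x‖ ^ 2) ≤ u₀ x) :
    ∃ τ A : ℝ, 0 < τ ∧ 0 < A ∧ ∀ x, Φ (A + b * ‖x‖ ^ 2) ≤ u τ x := by
  have hs := hu.isHeatSupersolution hf
  have hanti := (hΦ.strictAntiOn hf).antitoneOn
  obtain ⟨τ, A, R₁, hτ, hA, hfar⟩ :=
    hs.exists_tail_lower_bound hΦ hf hu.initial hu₀ hu₀0 hb hR hlow
  -- The unit ball about p lies in R ≤ |x| ≤ R + 2, where u₀ has a positive lower bound.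
  set p : EuclideanSpace ℝ (Fin N) := EuclideanSpace.single ⟨0, hN⟩ (R + 1) with hp
  have hpn : ‖p‖ = R + 1 := by
    rw [hp, PiLp.norm_single, Real.norm_of_nonneg (by linarith)]
  have hball : ∀ᵐ x, ‖x - p‖ ≤ 1 → Φ (b * (R + 2) ^ 2) ≤ u₀ x := by
    filter_upwards [hlow] with x hx hxp
    have h1 : R ≤ ‖x‖ := by
      have := norm_sub_norm_le p x
      rw [norm_sub_rev] at this
      linarith
    have h2 : ‖x‖ ≤ R + 2 := by linarith [norm_sub_norm_le x p]
    have hx0 : 0 < ‖x‖ := hR.trans_le h1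
    refine (hanti (show 0 < b * ‖x‖ ^ 2 by positivity)
      (show 0 < b * (R + 2) ^ 2 by positivity) ?_).trans (hx h1)
    gcongr
  have hupos : ∀ x, 0 < u τ x :=
    hs.pos hu.initial hu₀ hu₀0 (hΦ.pos _ (by positivity)) hball hτ
  obtain ⟨x₀, -, hx₀⟩ := (isCompact_closedBall (0 : EuclideanSpace ℝ (Fin N)) |R₁|).exists_isMinOn
    ⟨0, by simp⟩ (hu.isC21.contDiff_space τ hτ).continuous.continuousOn
  -- The second entry forces Φ(A + b|x|²) below the minimum of u(τ) over the ball.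
  refine ⟨τ, max A (realTail f (u τ x₀)), hτ, lt_max_of_lt_left hA, fun x => ?_⟩
  have hbx : 0 ≤ b * ‖x‖ ^ 2 := by positivity
  by_cases hx : R₁ ≤ ‖x‖
  · refine (hanti (show 0 < A + b * ‖x‖ ^ 2 by positivity)
      (show 0 < max A (realTail f (u τ x₀)) + b * ‖x‖ ^ 2 by positivity) ?_).trans (hfar x hx)
    gcongr
    exact le_max_left _ _
  · have hmin : u τ x₀ ≤ u τ x := hx₀ (by
      rw [mem_closedBall_zero_iff]
      exact (not_le.1 hx).le.trans (le_abs_self _))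
    refine (hΦ.le_of_realTail_le hf (hupos x₀) (by positivity) ?_).trans hmin
    linarith [le_max_right A (realTail f (u τ x₀))]

/-! ### From the hypotheses to the conclusion. -/

lemma isConvexReaction_of_contDiffOn {f : ℝ → ℝ} (hf_C1 : ContDiffOn ℝ 1 f (Ici 0))
    (hf_zero : f 0 = 0) (hf_pos : ∀ s, 0 < s → 0 < f s)
    (hf_deriv_pos : ∀ s, 0 < s → 0 < deriv f s)
    (hf_deriv2_pos : ∀ s, 0 < s → 0 < deriv (deriv f) s)
    (hF : ∀ s, 0 < s → tailIntegral f s < ∞) : IsConvexReaction f where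
  zero := hf_zero
  pos := hf_pos
  deriv_pos := hf_deriv_pos
  -- `deriv` is 0 at points of non-differentiability, so its positivity implies differentiability;
  -- the same holds for f' below.
  differentiableAt s hs := differentiableAt_of_deriv_ne_zero (hf_deriv_pos s hs).ne'
  deriv_mono := by
    refine (strictMonoOn_of_deriv_pos (convex_Ioi 0) (fun s hs => ?_) fun s hs => ?_).monotoneOn
    · exact (differentiableAt_of_deriv_ne_zero
        (hf_deriv2_pos s hs).ne').continuousAt.continuousWithinAt
    · exact hf_deriv2_pos s (interior_subset hs)
  continuousOn := hf_C1.continuousOn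
  tail_lt_top := hF

/-- The growth condition at infinity gives a pointwise lower bound on the initial value. -/
lemma IsTailInverse.exists_le_of_lt_liminf {N : ℕ} {f Φ : ℝ → ℝ} (hΦ : IsTailInverse f Φ)
    (hf : IsConvexReaction f) {u₀ : EuclideanSpace ℝ (Fin N) → ℝ} (hu₀0 : ∀ᵐ x, 0 ≤ u₀ x) {γ : ℝ}
    (hγ : 0 < γ)
    (h : ENNReal.ofReal γ < liminf (fun x => ENNReal.ofReal (‖x‖ ^ 2) / tailIntegral f (u₀ x))
      (comap (fun x => ‖x‖) atTop ⊓ ae volume)) :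
    ∃ R, 0 < R ∧ ∀ᵐ x, R ≤ ‖x‖ → Φ (γ⁻¹ * ‖x‖ ^ 2) ≤ u₀ x := by
  have hev := eventually_lt_of_lt_liminf h
  rw [eventually_inf] at hev
  obtain ⟨s, hs, t, ht, hst⟩ := hev
  obtain ⟨R, -, hR⟩ := (atTop_basis.comap (fun x : EuclideanSpace ℝ (Fin N) => ‖x‖)).mem_iff.1 hs
  refine ⟨max R 1, by positivity, ?_⟩
  filter_upwards [ht, hu₀0] with x hxt hx0 hx
  have hlt := hst x ⟨hR ((le_max_left _ _).trans hx), hxt⟩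
  have hx1 : 1 ≤ ‖x‖ := (le_max_right _ _).trans hx
  rcases hx0.eq_or_lt with h0 | h0
  -- Where u₀ vanishes the quotient is 0, because F(0) = ∞, and so cannot exceed γ.
  · rw [← h0, hf.tailIntegral_zero, ENNReal.div_top] at hlt
    exact absurd hlt not_lt_zero
  · refine hΦ.le_of_realTail_le hf h0 (by positivity) ?_
    rw [← hf.ofReal_realTail h0] at hlt
    by_contra! hcon
    have hpos : 0 < realTail f (u₀ x) := lt_trans (by positivity) hcon
    rw [← ENNReal.ofReal_div_of_pos hpos, ENNReal.ofReal_lt_ofReal_iff (by positivity),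
      lt_div_iff₀ hpos] at hlt
    rw [inv_mul_lt_iff₀ hγ] at hcon
    linarith

theorem theorem1p3 (N : ℕ) (hN : 1 ≤ N) (f : ℝ → ℝ)
    (hf_C1 : ContDiffOn ℝ 1 f (Ici 0)) (hf_C2 : ContDiffOn ℝ 2 f (Ioi 0))
    (hf_zero : f 0 = 0) (hf_pos : ∀ s, 0 < s → 0 < f s)
    (hf_deriv_pos : ∀ s, 0 < s → 0 < deriv f s)
    (hf_deriv2_pos : ∀ s, 0 < s → 0 < deriv (deriv f) s)
    (hF : ∀ s, 0 < s → tailIntegral f s < ∞)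
    (q : ℝ≥0∞)
    (hq : Tendsto (fun s => ENNReal.ofReal (deriv f s) * tailIntegral f s) (𝓝[>] 0) (𝓝 q))
    (hq_one : q = 1 → ∃ s₀ : ℝ, 0 < s₀ ∧ ∀ s, 0 < s → s < s₀ →
      1 ≤ ENNReal.ofReal (deriv f s) * tailIntegral f s) :
    ∃ Γ : ℝ, 0 < Γ ∧ ∀ u₀ : EuclideanSpace ℝ (Fin N) → ℝ,
      MemLp u₀ ∞ volume → (∀ᵐ x, 0 ≤ u₀ x) →
      ENNReal.ofReal Γ ≤ liminf (fun x => ENNReal.ofReal (‖x‖ ^ 2) / tailIntegral f (u₀ x))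
        (comap (fun x => ‖x‖) atTop ⊓ ae volume) →
      ¬ ∃ u : ℝ → EuclideanSpace ℝ (Fin N) → ℝ, IsGlobalSolution f u₀ u := by
  have hf := isConvexReaction_of_contDiffOn hf_C1 hf_zero hf_pos hf_deriv_pos hf_deriv2_pos hF
  obtain ⟨Φ, hΦ⟩ := hf.exists_isTailInverse
  have hN0 : (0 : ℝ) < N := by exact_mod_cast hN
  -- Any constant above 2N would serve: 3N lies strictly between 2N and 4N, giving a strict bound
  -- below the lower limit and 2Nb < 1 for b = 1/(3N).
  refine ⟨4 * N, by positivity, fun u₀ hu₀ hu₀0 hlim ⟨u, hu⟩ => ?_⟩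
  obtain ⟨R, hR, hlow⟩ := hΦ.exists_le_of_lt_liminf hf hu₀0 (γ := 3 * N) (by positivity)
    (lt_of_lt_of_le ((ENNReal.ofReal_lt_ofReal_iff (by positivity)).2 (by linarith)) hlim)
  have hb : 0 < (3 * N : ℝ)⁻¹ := by positivity
  obtain ⟨τ, A, hτ, hA, hge⟩ := hu.exists_lower_bound hN hΦ hf
    (hu₀.locallyIntegrable le_top) hu₀0 hb hR hlow
  refine hu.false_of_lower_bound hΦ hf hb ?_ hτ hA hge
  rw [← div_eq_mul_inv, div_lt_one (by positivity)]
  linarith
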